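/- A (Hausdorff) CW complex $X$ is called a \emph{regular cell complex} (RCC) if the attaching map $S^{k-1}\to X^{k-1}$ of every $k$-cell is injective and the intersection of the closures of any two cells is either empty or the closure of a cell. Given a homeomorphism $h$ from a simplicial complex onto $X$, the images under $h$ of simplices and of vertices are called simplices and vertices of $X$. Call $h$ a \emph{conical triangulation} of $X$ if 1. the closure $\bar e$ and the boundary $\partial e$ of every cell $e$ are unions of simplices (so they are triangulated by subcomplexes); 2. every $0$-cell is a vertex and the closure of every $1$-cell is a single $1$-simplex; 3. every closed cell $\bar e$ of dimension $k\ge 2$ is triangulated as the cone over its triangulated boundary: there is a vertex $c$ in the open cell $e$ such that the simplices contained in $\bar e$ are exactly the simplices contained in $\partial e$, the vertex $c$, and the simplices spanned by $c$ and the vertices of a simplex contained in $\partial e$. **Theorem.** Every regular cell complex is triangulable. More precisely, let $X$ be a regular cell complex. (a) There are an abstract simplicial complex $K$ and a homeomorphism $h:|K|\to X$ that is a conical triangulation, where the geometric realization $|K|$ carries the weak topology. (b) If moreover $X$ is finite-dimensional, has countably many cells, and is locally finite (every point has a neighbourhood meeting only finitely many closed cells) — in particular if $X$ is finite — then there are an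 $m$ and a geometric simplicial complex $S$ in $\mathbb R^m$ such that every point of its support $|S|\subset\mathbb R^m$ has a neighbourhood meeting only finitely many simplices of $S$, and a homeomorphism $h:|S|\to X$ that is a conical triangulation, where $|S|$ carries the subspace topology. -/

import Mathlib

open Set Metric Topology

noncomputable section

namespace RegularCell

universe u v

/-! ### Regular cell complexes -/

/-- A CW complex is *regular* if the characteristic map of every cell is injective on the boundary
sphere, and any two closed cells are either disjoint or meet in a closed cell.
(For `n`-cells Mathlib uses the unit ball and sphere of the sup norm on `Fin n → ℝ`.) -/
structure IsRegular {X : Type u} [TopologicalSpace X] (C : Set X) [CWComplex C] : Prop where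
  injOn_sphere : ∀ (n : ℕ) (e : RelCWComplex.cell C n),
    InjOn (RelCWComplex.map n e) (sphere (0 : Fin n → ℝ) 1)
  closedCell_inter : ∀ (n m : ℕ) (e : RelCWComplex.cell C n) (f : RelCWComplex.cell C m),
    RelCWComplex.closedCell n e ∩ RelCWComplex.closedCell m f = ∅ ∨
      ∃ (k : ℕ) (g : RelCWComplex.cell C k),
        RelCWComplex.closedCell n e ∩ RelCWComplex.closedCell m f = RelCWComplex.closedCell k g

/-- Every point has a neighbourhood that meets only finitely many closed cells. -/
def IsLocallyFinite {X : Type u} [TopologicalSpace X] (C : Set X) [CWComplex C] : Prop :=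
  LocallyFinite fun e : Σ n, RelCWComplex.cell C n ↦ RelCWComplex.closedCell e.1 e.2

/-! ### The geometric realization of an abstract simplicial complex -/

/-- The points of the realization: finitely supported systems of barycentric coordinates whose
support is a face. -/
def Realization {V : Type v} (K : AbstractSimplicialComplex V) : Type v :=
  {x : V →₀ ℝ // (∀ a, 0 ≤ x a) ∧ (x.sum fun _ r ↦ r) = 1 ∧ x.support ∈ K.faces}

/-- The closed simplex of the realization spanned by a finite set of vertices. -/
def closedSimplex {V : Type v} (K : AbstractSimplicialComplex V) (s : Finset V) :
    Set (Realization K) :=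
  {p | p.1.support ⊆ s}

/-- The weak topology: each closed simplex has the Euclidean topology given by its finitely many
barycentric coordinates, and a set is open iff it meets each closed simplex in an open subset of
that simplex. -/
instance {V : Type v} (K : AbstractSimplicialComplex V) : TopologicalSpace (Realization K) :=
  ⨆ s : K.faces, TopologicalSpace.coinduced
    (Subtype.val : closedSimplex K (s : Finset V) → Realization K)
    (TopologicalSpace.induced (fun p (a : V) ↦ p.1.1 a) Pi.topologicalSpace)

/-! ### Locally finite geometric simplicial complexes in Euclidean space -/

/-- Every point of the support of `S` has a neighbourhood that meets only finitely many simplices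
of `S`. -/
def LocallyFiniteComplex {m : ℕ}
    (S : Geometry.SimplicialComplex ℝ (EuclideanSpace ℝ (Fin m))) : Prop :=
  ∀ x ∈ S.space, ∃ U ∈ 𝓝 x,
    {s ∈ S.faces | (convexHull ℝ (s : Set (EuclideanSpace ℝ (Fin m))) ∩ U).Nonempty}.Finite

/-! ### Triangulations that triangulate the cells -/

/-- `A` is a union of the (curvilinear) simplices `τ s`, `s ∈ F`, contained in it. -/
def IsUnionOfSimplices {X : Type u} {V : Type v} (F : Set (Finset V)) (τ : Finset V → Set X)
    (A : Set X) : Prop :=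
  A = ⋃ s ∈ {s ∈ F | τ s ⊆ A}, τ s

/-- Let `F` be the set of faces of a triangulation of the CW complex `C` and let `τ s` be the
curvilinear simplex of `C` with vertex set `s ∈ F`. The triangulation is *conical* if the closed
cells and their boundaries are subcomplexes, the 0-cells are vertices, the closed 1-cells are edges,
and every closed cell of dimension at least 2 is the cone over its boundary, the apex being a vertex
in the open cell. -/
structure IsConical {X : Type u} [TopologicalSpace X] (C : Set X) [CWComplex C] {V : Type v}
    (F : Set (Finset V)) (τ : Finset V → Set X) : Prop where
  closedCell_subcomplex : ∀ (n : ℕ) (e : RelCWComplex.cell C n),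
    IsUnionOfSimplices F τ (RelCWComplex.closedCell n e)
  cellFrontier_subcomplex : ∀ (n : ℕ) (e : RelCWComplex.cell C n),
    IsUnionOfSimplices F τ (RelCWComplex.cellFrontier n e)
  zero_cell : ∀ e : RelCWComplex.cell C 0,
    ∃ s ∈ F, s.card = 1 ∧ τ s = RelCWComplex.closedCell 0 e
  one_cell : ∀ e : RelCWComplex.cell C 1,
    ∃ s ∈ F, s.card = 2 ∧ τ s = RelCWComplex.closedCell 1 e
  cone : ∀ (n : ℕ) (e : RelCWComplex.cell C n), 2 ≤ n →
    ∃ c : V, τ {c} ⊆ RelCWComplex.openCell n e ∧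
      {s ∈ F | τ s ⊆ RelCWComplex.closedCell n e} =
        {s ∈ F | τ s ⊆ RelCWComplex.cellFrontier n e} ∪ {{c}} ∪
        {s | ∃ t ∈ F, τ t ⊆ RelCWComplex.cellFrontier n e ∧ (s : Set V) = insert c (t : Set V)}

/-- A conical triangulation of `C` by the realization, with the weak topology, of an abstract
simplicial complex. -/
def HasConicalTriangulation {X : Type u} [TopologicalSpace X] (C : Set X) [CWComplex C] : Prop :=
  ∃ (V : Type u) (K : AbstractSimplicialComplex V) (h : Realization K ≃ₜ C),
    IsConical C K.faces fun s ↦ (fun p ↦ (h p : X)) '' closedSimplex K s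

/-- A conical triangulation of `C` by a locally finite geometric simplicial complex in some `ℝᵐ`,
whose support carries the subspace topology. -/
def HasEuclideanConicalTriangulation {X : Type u} [TopologicalSpace X] (C : Set X)
    [CWComplex C] : Prop :=
  ∃ (m : ℕ) (S : Geometry.SimplicialComplex ℝ (EuclideanSpace ℝ (Fin m))) (h : S.space ≃ₜ C),
    LocallyFiniteComplex S ∧
    IsConical C S.faces fun s ↦
      (fun p ↦ (h p : X)) '' {p | (p : EuclideanSpace ℝ (Fin m)) ∈ convexHull ℝ (s : Set _)}

end RegularCell

end

/-! The characteristic map of a cell exhibits it as the cone from its centre over its boundary. By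
regularity the map is injective on the sphere, and the boundary is a union of closed cells of lower
dimension, so the cells can be coned off by induction on dimension. Instead of gluing simplices, the
proof defines barycentric coordinates `bary` by recursion on dimension, linear along each radius of
a cell (`bary_map`). The vertices are the centres of the cells of dimension other than 1. The
midpoint of an edge gets weight 1/2 at each end, so that the edge stays a single simplex
(`exists_ends`).

The faces are the supports of the values of `bary`. Every system of weights carried by a face is
attained (`exists_bary_eq`), and `bary` is injective (`bary_injOn`): the support determines the open
cell of a point, and along radii the question descends to the boundary. These two facts make the
triangulation conical (`isConical_faces`).

The coordinates are continuous on closed cells (`continuousOn_bary`), and a closed cell is covered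
by finitely many compact simplices. So the coordinate map is continuous on the whole complex, and
its inverse is continuous on each simplex by compactness; for the weak topology this gives a
homeomorphism.

For the Euclidean version the vertices are placed at distinct natural parameters on a moment curve.
The Vandermonde determinant puts them in general position (`eq_of_momentMap_eq`), so simplices are
embedded and meet properly. Since the parameters tend to infinity along the vertices, local
finiteness of the cells becomes local finiteness of the simplices. -/

open Set Metric Topology

noncomputable section

namespace RegularCell

universe u v

/-! ### The cells of a CW complex -/

section Cells

variable {X : Type u} [TopologicalSpace X] {C : Set X} [CWComplex C]

variable (C) in
/-- The cells of a CW complex, of all dimensions. -/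
abbrev Cell : Type u := Σ n, RelCWComplex.cell C n

/-- The characteristic map of a cell. -/
def Cell.map (e : Cell C) : (Fin e.1 → ℝ) → X := RelCWComplex.map e.1 e.2

/-- The open cell. -/
def Cell.opn (e : Cell C) : Set X := RelCWComplex.openCell e.1 e.2

/-- The closed cell. -/
def Cell.cls (e : Cell C) : Set X := RelCWComplex.closedCell e.1 e.2

/-- The boundary of a cell. -/
def Cell.bdry (e : Cell C) : Set X := RelCWComplex.cellFrontier e.1 e.2

namespace Cell

lemma cls_eq (e : Cell C) : e.cls = e.map '' closedBall 0 1 := rfl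

lemma map_mem_opn (e : Cell C) {u : Fin e.1 → ℝ} (hu : ‖u‖ < 1) : e.map u ∈ e.opn :=
  mem_image_of_mem _ (by simpa using hu)

lemma map_mem_cls (e : Cell C) {u : Fin e.1 → ℝ} (hu : ‖u‖ ≤ 1) : e.map u ∈ e.cls :=
  mem_image_of_mem _ (by simpa using hu)

lemma map_mem_bdry (e : Cell C) {u : Fin e.1 → ℝ} (hu : ‖u‖ = 1) : e.map u ∈ e.bdry :=
  mem_image_of_mem _ (by simpa using hu)

lemma exists_of_mem_opn {e : Cell C} {x : X} (hx : x ∈ e.opn) : ∃ u, ‖u‖ < 1 ∧ e.map u = x := by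
  obtain ⟨u, hu, rfl⟩ := hx
  exact ⟨u, by simpa using hu, rfl⟩

lemma exists_of_mem_cls {e : Cell C} {x : X} (hx : x ∈ e.cls) : ∃ u, ‖u‖ ≤ 1 ∧ e.map u = x := by
  obtain ⟨u, hu, rfl⟩ := hx
  exact ⟨u, by simpa using hu, rfl⟩

lemma exists_of_mem_bdry {e : Cell C} {x : X} (hx : x ∈ e.bdry) :
    ∃ u, ‖u‖ = 1 ∧ e.map u = x := by
  obtain ⟨u, hu, rfl⟩ := hx
  exact ⟨u, by simpa using hu, rfl⟩

lemma opn_subset_cls (e : Cell C) : e.opn ⊆ e.cls := RelCWComplex.openCell_subset_closedCell _ _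

lemma bdry_subset_cls (e : Cell C) : e.bdry ⊆ e.cls :=
  RelCWComplex.cellFrontier_subset_closedCell _ _

lemma cls_subset (e : Cell C) : e.cls ⊆ C := RelCWComplex.closedCell_subset_complex _ _

lemma mem_bdry_or_mem_opn {e : Cell C} {x : X} (hx : x ∈ e.cls) : x ∈ e.bdry ∨ x ∈ e.opn := by
  have := RelCWComplex.cellFrontier_union_openCell_eq_closedCell e.1 e.2
  exact this.symm.subset hx

lemma continuousOn_map (e : Cell C) : ContinuousOn e.map (closedBall 0 1) :=
  RelCWComplex.continuousOn e.1 e.2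

lemma injOn_map_ball (e : Cell C) : InjOn e.map (ball 0 1) := by
  have := (RelCWComplex.map e.1 e.2).injOn
  rwa [RelCWComplex.source_eq] at this

lemma isCompact_cls (e : Cell C) : IsCompact e.cls := RelCWComplex.isCompact_closedCell

lemma eq_of_mem_opn {e f : Cell C} {x : X} (he : x ∈ e.opn) (hf : x ∈ f.opn) : e = f :=
  RelCWComplex.eq_of_not_disjoint_openCell (Set.not_disjoint_iff.2 ⟨x, he, hf⟩)

lemma exists_mem_opn {x : X} (hx : x ∈ C) : ∃ e : Cell C, x ∈ e.opn := by
  rw [← CWComplex.iUnion_openCell_eq_complex (C := C)] at hx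
  simp only [mem_iUnion] at hx
  obtain ⟨n, e, h⟩ := hx
  exact ⟨⟨n, e⟩, h⟩

lemma exists_finset_bdry_subset (e : Cell C) :
    ∃ I : Finset (Cell C), (∀ f ∈ I, f.1 < e.1) ∧ e.bdry ⊆ ⋃ f ∈ I, f.opn := by
  obtain ⟨I, hI⟩ := CWComplex.cellFrontier_subset_finite_openCell e.1 e.2
  refine ⟨(Finset.range e.1).sigma I, fun f hf ↦ by simp at hf; exact hf.1, fun x hx ↦ ?_⟩
  have := hI hx
  simp only [mem_iUnion] at this ⊢
  obtain ⟨m, hm, j, hj, hx⟩ := this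
  exact ⟨⟨m, j⟩, by simp [hm, hj], hx⟩

lemma exists_lt_of_mem_bdry {e : Cell C} {x : X} (hx : x ∈ e.bdry) :
    ∃ f : Cell C, f.1 < e.1 ∧ x ∈ f.opn := by
  obtain ⟨I, hI, h⟩ := e.exists_finset_bdry_subset
  have := h hx
  simp only [mem_iUnion] at this
  obtain ⟨f, hf, hx⟩ := this
  exact ⟨f, hI f hf, hx⟩

lemma eq_or_lt_of_mem {e f : Cell C} {x : X} (he : x ∈ e.cls) (hf : x ∈ f.opn) :
    f = e ∨ f.1 < e.1 := by
  rcases mem_bdry_or_mem_opn he with h | h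
  · obtain ⟨g, hg, hx⟩ := exists_lt_of_mem_bdry h
    exact .inr (eq_of_mem_opn hf hx ▸ hg)
  · exact .inl (eq_of_mem_opn hf h)

lemma map_zero_mem_opn (e : Cell C) : e.map 0 ∈ e.opn := e.map_mem_opn (by simp)

lemma eq_or_lt_of_subset {e f : Cell C} (h : f.cls ⊆ e.cls) : f = e ∨ f.1 < e.1 :=
  eq_or_lt_of_mem (h (opn_subset_cls _ f.map_zero_mem_opn)) f.map_zero_mem_opn

lemma finite_subset_cls (e : Cell C) : {f : Cell C | f.cls ⊆ e.cls}.Finite := by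
  classical
  obtain ⟨I, -, h⟩ := e.exists_finset_bdry_subset
  refine (insert e I).finite_toSet.subset fun f hf ↦ ?_
  have h0 := f.map_zero_mem_opn
  rcases mem_bdry_or_mem_opn (hf (opn_subset_cls _ h0)) with h1 | h1
  · have := h h1
    simp only [mem_iUnion] at this
    obtain ⟨g, hg, hx⟩ := this
    obtain rfl := eq_of_mem_opn h0 hx
    simp [hg]
  · simp [eq_of_mem_opn h0 h1]

lemma cls_eq_singleton {e : Cell C} (he : e.1 = 0) : e.cls = {e.map 0} := by
  obtain ⟨n, j⟩ := e
  obtain rfl : n = 0 := he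
  ext x
  constructor
  · intro hx
    obtain ⟨u, -, rfl⟩ := exists_of_mem_cls hx
    rw [Subsingleton.elim u 0]; rfl
  · rintro rfl
    exact map_mem_cls _ (by simp)

end Cell

/-! ### Incidence of closed cells under regularity. -/

variable (hC : IsRegular C)
include hC

namespace Cell

lemma injOn_map_sphere (e : Cell C) : InjOn e.map (sphere 0 1) := hC.injOn_sphere e.1 e.2

/-- The two closures meet in a closed cell `g` containing `x`. Since `x` is in the open cell `f`,
either `f = g` or `f` has smaller dimension; since `g.cls ⊆ f.cls`, the reverse also holds. Hence `f
= g`. -/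
lemma cls_subset_cls {e f : Cell C} {x : X} (hf : x ∈ f.opn) (he : x ∈ e.cls) :
    f.cls ⊆ e.cls := by
  rcases hC.closedCell_inter f.1 e.1 f.2 e.2 with h | ⟨k, g, h⟩
  · exact absurd h (Set.Nonempty.ne_empty ⟨x, opn_subset_cls _ hf, he⟩)
  · have h' : f.cls ∩ e.cls = Cell.cls (⟨k, g⟩ : Cell C) := h
    have hx : x ∈ Cell.cls (⟨k, g⟩ : Cell C) := h' ▸ ⟨opn_subset_cls _ hf, he⟩
    have h1 := eq_or_lt_of_mem hx hf
    have h2 := eq_or_lt_of_subset (h'.symm.subset.trans inter_subset_left)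
    have : f = ⟨k, g⟩ := by
      rcases h1 with h1 | h1
      · exact h1
      · rcases h2 with h2 | h2
        · exact h2.symm
        · exact absurd h1 h2.not_gt
    rw [← this] at h'
    exact h'.symm.subset.trans inter_subset_right

/-- Here `f` has smaller dimension than `e`, so its closure, which lies in `e.cls`, cannot reach the
open cell `e`. -/
lemma cls_subset_bdry {e f : Cell C} {x : X} (hf : x ∈ f.opn) (he : x ∈ e.bdry) :
    f.cls ⊆ e.bdry := by
  obtain ⟨g, hg, hxg⟩ := exists_lt_of_mem_bdry he
  obtain rfl := eq_of_mem_opn hf hxg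
  intro y hy
  rcases mem_bdry_or_mem_opn (cls_subset_cls hC hf (e.bdry_subset_cls he) hy) with h | h
  · exact h
  · rcases eq_or_lt_of_mem hy h with rfl | h'
    · exact absurd hg (lt_irrefl _)
    · exact absurd hg h'.not_gt

lemma exists_cls_subset_bdry {e : Cell C} {x : X} (he : x ∈ e.bdry) :
    ∃ f : Cell C, f.1 < e.1 ∧ x ∈ f.opn ∧ f.cls ⊆ e.bdry := by
  obtain ⟨f, hf, hx⟩ := exists_lt_of_mem_bdry he
  exact ⟨f, hf, hx, cls_subset_bdry hC hx he⟩

/-- Two cells of dimension 1 whose closures share two points coincide. -/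
lemma eq_of_two_mem {e f : Cell C} (he : e.1 = 1) (hf : f.1 = 1) {x y : X} (hxy : x ≠ y)
    (hx : x ∈ e.cls ∩ f.cls) (hy : y ∈ e.cls ∩ f.cls) : e = f := by
  rcases hC.closedCell_inter e.1 f.1 e.2 f.2 with h | ⟨k, g, h⟩
  · exact absurd h (Set.Nonempty.ne_empty ⟨x, hx⟩)
  · have h' : e.cls ∩ f.cls = Cell.cls (⟨k, g⟩ : Cell C) := h
    -- A closed 0-cell is one point, so the common cell has positive dimension and must be each of
    -- the two edges.
    have hk : k ≠ 0 := by
      intro hk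
      rw [h', cls_eq_singleton hk] at hx hy
      exact hxy (hx.trans hy.symm)
    have h1 := eq_or_lt_of_subset (h'.symm.subset.trans inter_subset_left)
    have h2 := eq_or_lt_of_subset (h'.symm.subset.trans inter_subset_right)
    rw [he] at h1
    rw [hf] at h2
    have h1 := h1.resolve_right (by simp [hk])
    have h2 := h2.resolve_right (by simp [hk])
    exact h1.symm.trans h2

end Cell

end Cells

/-! ### Barycentric coordinates -/

section Barycentric

variable {X : Type u} [TopologicalSpace X] {C : Set X} [CWComplex C]

lemma exists_chart {x : X} (hx : x ∈ C) :
    ∃ d : Σ e : Cell C, (Fin e.1 → ℝ), ‖d.2‖ < 1 ∧ d.1.map d.2 = x := by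
  obtain ⟨e, he⟩ := Cell.exists_mem_opn hx
  obtain ⟨u, hu, h⟩ := Cell.exists_of_mem_opn he
  exact ⟨⟨e, u⟩, hu, h⟩

variable (C) in
/-- The open cell containing a given point, and the coordinates of the point in it. -/
def chart (x : X) (hx : x ∈ C) : Σ e : Cell C, (Fin e.1 → ℝ) := (exists_chart hx).choose

lemma chart_spec {x : X} (hx : x ∈ C) :
    ‖(chart C x hx).2‖ < 1 ∧ (chart C x hx).1.map (chart C x hx).2 = x :=
  (exists_chart hx).choose_spec

lemma chart_map (e : Cell C) {u : Fin e.1 → ℝ} (hu : ‖u‖ < 1) (h : e.map u ∈ C) :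
    chart C (e.map u) h = ⟨e, u⟩ := by
  obtain ⟨h1, h2⟩ := chart_spec h
  generalize chart C (e.map u) h = d at h1 h2
  obtain ⟨f, w⟩ := d
  obtain rfl := Cell.eq_of_mem_opn (h2 ▸ f.map_mem_opn h1) (e.map_mem_opn hu)
  have : w = u := f.injOn_map_ball (by simpa using h1) (by simpa using hu) h2
  rw [this]

variable (C) in
/-- The dimension of the open cell containing a given point. -/
def dim (x : X) : ℕ :=
  open Classical in if hx : x ∈ C then (chart C x hx).1.1 else 0

lemma dim_eq {e : Cell C} {x : X} (hx : x ∈ e.opn) : dim C x = e.1 := by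
  obtain ⟨u, hu, rfl⟩ := Cell.exists_of_mem_opn hx
  have h : e.map u ∈ C := e.cls_subset (e.map_mem_cls hu.le)
  rw [dim, dif_pos h, chart_map e hu h]

variable (C) in
/-- The vertices of the triangulation: a cell of dimension other than 1 stands for its centre. -/
abbrev Vertex : Type u := {e : Cell C // e.1 ≠ 1}

variable (C) in
/-- The barycentric coordinates of the centre of the open cell containing a given point, if this
cell is not an edge. -/
def centre (x : X) : Vertex C →₀ ℝ :=
  open Classical in if h : ∃ v : Vertex C, x ∈ v.1.opn then Finsupp.single h.choose 1 else 0

lemma centre_eq (v : Vertex C) {x : X} (hx : x ∈ v.1.opn) :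
    centre C x = Finsupp.single v 1 := by
  have h : ∃ v : Vertex C, x ∈ v.1.opn := ⟨v, hx⟩
  rw [centre, dif_pos h, Subtype.ext (Cell.eq_of_mem_opn h.choose_spec hx)]

/-- The barycentric coordinates of the centre of a cell. -/
def apex (e : Cell C) : Vertex C →₀ ℝ :=
  if h : e.1 ≠ 1 then Finsupp.single ⟨e, h⟩ 1 else
    (1 / 2 : ℝ) • (centre C (e.map fun _ ↦ -1) + centre C (e.map fun _ ↦ 1))

variable (C) in
/-- The barycentric coordinates of a point with respect to the conical triangulation: every cell
is the cone over its boundary. -/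
def bary (x : X) : Vertex C →₀ ℝ :=
  open Classical in
  if hx : x ∈ C then
    (1 - ‖(chart C x hx).2‖) • apex (chart C x hx).1 + ‖(chart C x hx).2‖ •
      (if dim C ((chart C x hx).1.map (‖(chart C x hx).2‖⁻¹ • (chart C x hx).2)) < dim C x then
        bary ((chart C x hx).1.map (‖(chart C x hx).2‖⁻¹ • (chart C x hx).2)) else 0)
  else 0
termination_by dim C x

lemma norm_normalize {n : ℕ} {u : Fin n → ℝ} (hu : u ≠ 0) : ‖‖u‖⁻¹ • u‖ = 1 := by
  rw [norm_smul, norm_inv, norm_norm, inv_mul_cancel₀ (norm_ne_zero_iff.2 hu)]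

/-- The comparison of dimensions in `bary` only secures termination: off the centre the radial
projection lies in a cell of lower dimension, and at the centre the second term has coefficient 0.
-/
lemma bary_map (e : Cell C) {u : Fin e.1 → ℝ} (hu : ‖u‖ ≤ 1) :
    bary C (e.map u) = (1 - ‖u‖) • apex e + ‖u‖ • bary C (e.map (‖u‖⁻¹ • u)) := by
  rcases hu.eq_or_lt with h1 | h1
  · simp [h1]
  · have h : e.map u ∈ C := e.cls_subset (e.map_mem_cls hu)
    rw [bary, dif_pos h]
    have hd := chart_map e h1 h
    generalize chart C (e.map u) h = d at hd
    subst hd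
    rcases eq_or_ne u 0 with rfl | h0
    · simp
    · obtain ⟨f, hf, hx⟩ := Cell.exists_lt_of_mem_bdry (e.map_mem_bdry (norm_normalize h0))
      rw [if_pos]
      rwa [dim_eq hx, dim_eq (e.map_mem_opn h1)]

lemma bary_map_zero (e : Cell C) : bary C (e.map 0) = apex e := by
  rw [bary_map e (u := 0) (by simp)]
  simp only [norm_zero, sub_zero, one_smul, zero_smul, add_zero]

lemma bary_map_smul (e : Cell C) {u : Fin e.1 → ℝ} (hu : ‖u‖ = 1) {t : ℝ} (ht0 : 0 ≤ t)
    (ht1 : t ≤ 1) :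
    bary C (e.map (t • u)) = (1 - t) • apex e + t • bary C (e.map u) := by
  have hn : ‖t • u‖ = t := by rw [norm_smul, hu, mul_one, Real.norm_of_nonneg ht0]
  rw [bary_map e (hn.trans_le ht1), hn]
  rcases ht0.eq_or_lt with rfl | h
  · simp
  · rw [smul_smul, inv_mul_cancel₀ h.ne', one_smul]

lemma apex_of_ne (v : Vertex C) : apex v.1 = Finsupp.single v 1 := dif_pos v.2

lemma bary_of_dim_zero (v : Vertex C) (hv : v.1.1 = 0) {x : X} (hx : x ∈ v.1.cls) :
    bary C x = Finsupp.single v 1 := by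
  rw [Cell.cls_eq_singleton hv] at hx
  rw [hx, bary_map_zero, apex_of_ne]

lemma norm_const {e : Cell C} (he : e.1 = 1) (t : ℝ) : ‖fun _ : Fin e.1 ↦ t‖ = |t| := by
  have : Nonempty (Fin e.1) := ⟨⟨0, by omega⟩⟩
  rw [pi_norm_const, Real.norm_eq_abs]

lemma eq_const {e : Cell C} (he : e.1 = 1) (u : Fin e.1 → ℝ) : ∃ t, u = fun _ ↦ t := by
  have : Subsingleton (Fin e.1) := by rw [he]; infer_instance
  exact ⟨u ⟨0, by omega⟩, funext fun i ↦ congrArg u (Subsingleton.elim _ _)⟩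

variable (hC : IsRegular C)
include hC

/-- The barycentric coordinates on an edge. -/
lemma exists_ends {e : Cell C} (he : e.1 = 1) : ∃ a b : Vertex C, a ≠ b ∧ a.1.1 = 0 ∧ b.1.1 = 0 ∧
    a.1.cls ⊆ e.bdry ∧ b.1.cls ⊆ e.bdry ∧ ∀ t : ℝ, |t| ≤ 1 →
      bary C (e.map fun _ ↦ t) =
        Finsupp.single a ((1 - t) / 2) + Finsupp.single b ((1 + t) / 2) := by
  have hend (t : ℝ) (ht : |t| = 1) : ∃ a : Vertex C, a.1.1 = 0 ∧ (e.map fun _ ↦ t) ∈ a.1.opn ∧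
      a.1.cls ⊆ e.bdry := by
    obtain ⟨f, hf, hx, hfe⟩ := Cell.exists_cls_subset_bdry hC
      (e.map_mem_bdry ((norm_const he t).trans ht))
    exact ⟨⟨f, by omega⟩, by simp; omega, hx, hfe⟩
  obtain ⟨a, ha, hxa, hae⟩ := hend (-1) (by simp)
  obtain ⟨b, hb, hxb, hbe⟩ := hend 1 (by simp)
  have hba := bary_of_dim_zero a ha (Cell.opn_subset_cls _ hxa)
  have hbb := bary_of_dim_zero b hb (Cell.opn_subset_cls _ hxb)
  have hapex : apex e = (1 / 2 : ℝ) • (Finsupp.single a 1 + Finsupp.single b 1) := by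
    rw [apex, dif_neg (by simpa using he), centre_eq a hxa, centre_eq b hxb]
  refine ⟨a, b, ?_, ha, hb, hae, hbe, fun t ht ↦ ?_⟩
  -- Equal ends would be one and the same point, against injectivity on the sphere `{-1, 1}`.
  · rintro rfl
    have h1 := Cell.opn_subset_cls _ hxa
    have h2 := Cell.opn_subset_cls _ hxb
    rw [Cell.cls_eq_singleton ha] at h1 h2
    have := Cell.injOn_map_sphere hC e (by simp [norm_const he]) (by simp [norm_const he])
      (h1.trans h2.symm)
    have := congrFun this ⟨0, by omega⟩
    norm_num at this
  · classical
    -- The cone formula is linear on each half of the edge; the halves fit into one affine formula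
    -- because the apex is the midpoint of the ends.
    rcases le_total 0 t with h | h
    · have h' : (fun _ : Fin e.1 ↦ t) = t • fun _ ↦ (1 : ℝ) := by ext; simp
      rw [h', bary_map_smul e (by simp [norm_const he]) h ((le_abs_self t).trans ht), hbb, hapex]
      ext v
      simp [Finsupp.single_apply]
      split_ifs <;> ring
    · have h' : (fun _ : Fin e.1 ↦ t) = (-t) • fun _ ↦ (-1 : ℝ) := by ext; simp
      rw [h', bary_map_smul e (by simp [norm_const he]) (by linarith)
        ((neg_le_abs t).trans ht), hba, hapex]
      ext v
      simp [Finsupp.single_apply]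
      split_ifs <;> ring

end Barycentric

/-- The sum of the coordinates of a finitely supported function. -/
def mass {V : Type v} : (V →₀ ℝ) →ₗ[ℝ] ℝ := Finsupp.linearCombination ℝ fun _ ↦ 1

lemma mass_apply {V : Type v} (p : V →₀ ℝ) : mass p = p.sum fun _ r ↦ r := by
  simp [mass, Finsupp.linearCombination_apply]

@[simp] lemma mass_single {V : Type v} (a : V) (r : ℝ) : mass (Finsupp.single a r) = r := by
  simp [mass]

lemma le_mass {V : Type v} {p : V →₀ ℝ} (hp : ∀ a, 0 ≤ p a) (a : V) : p a ≤ mass p := by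
  rw [mass_apply]
  by_cases ha : a ∈ p.support
  · exact Finset.single_le_sum (f := p) (fun i _ ↦ hp i) ha
  · rw [Finsupp.notMem_support_iff.1 ha]
    exact Finset.sum_nonneg fun i _ ↦ hp i

lemma eq_zero_of_mass {V : Type v} {p : V →₀ ℝ} (hp : ∀ a, 0 ≤ p a) (h : mass p = 0) : p = 0 := by
  ext a
  exact le_antisymm ((le_mass hp a).trans_eq h) (hp a)

/-! ### Coordinates as convex weights, and which weights are attained. -/

section Barycentric

variable {X : Type u} [TopologicalSpace X] {C : Set X} [CWComplex C]
variable (hC : IsRegular C)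

include hC

/-- Every point of a closed cell is the centre of the cell or lies on a segment from the centre to a
point on the boundary. -/
lemma bary_cases (e : Cell C) {x : X} (hx : x ∈ e.cls) : bary C x = apex e ∨
    ∃ t : ℝ, 0 < t ∧ t ≤ 1 ∧ ∃ f : Cell C, f.1 < e.1 ∧ f.cls ⊆ e.bdry ∧ ∃ y ∈ f.opn,
      bary C x = (1 - t) • apex e + t • bary C y := by
  obtain ⟨u, hu, rfl⟩ := Cell.exists_of_mem_cls hx
  rcases eq_or_ne u 0 with rfl | h0
  · exact .inl (bary_map_zero e)
  · right
    obtain ⟨f, hf, hxf, hfe⟩ := Cell.exists_cls_subset_bdry hC (e.map_mem_bdry (norm_normalize h0))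
    exact ⟨‖u‖, norm_pos_iff.2 h0, hu, f, hf, hfe, _, hxf, bary_map e hu⟩

lemma exists_ends_of_mem {e : Cell C} (he : e.1 = 1) : ∃ a b : Vertex C, a ≠ b ∧ a.1.1 = 0 ∧
    b.1.1 = 0 ∧ a.1.cls ⊆ e.bdry ∧ b.1.cls ⊆ e.bdry ∧
    (∀ x ∈ e.cls, ∃ t : ℝ, |t| ≤ 1 ∧ e.map (fun _ ↦ t) = x) ∧ ∀ t : ℝ, |t| ≤ 1 →
      bary C (e.map fun _ ↦ t) =
        Finsupp.single a ((1 - t) / 2) + Finsupp.single b ((1 + t) / 2) := by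
  obtain ⟨a, b, hab, ha, hb, hae, hbe, h⟩ := exists_ends hC he
  refine ⟨a, b, hab, ha, hb, hae, hbe, fun x hx ↦ ?_, h⟩
  obtain ⟨u, hu, rfl⟩ := Cell.exists_of_mem_cls hx
  obtain ⟨t, rfl⟩ := eq_const he u
  exact ⟨t, by rwa [norm_const he] at hu, rfl⟩

/-- All three properties pass through convex combinations of the apex with a boundary point. Edges
are separate because their apex is not a vertex. -/
lemma bary_nonneg_mass (e : Cell C) : ∀ x ∈ e.cls,
    (∀ v, 0 ≤ bary C x v) ∧ mass (bary C x) = 1 ∧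
      ∀ v : Vertex C, bary C x v ≠ 0 → v.1.cls ⊆ e.cls := by
  classical
  induction hn : e.1 using Nat.strong_induction_on generalizing e with
  | _ n ih =>
  subst hn
  intro x hx
  by_cases he : e.1 = 1
  · obtain ⟨a, b, -, -, -, hae, hbe, hmem, h⟩ := exists_ends_of_mem hC he
    obtain ⟨t, ht, rfl⟩ := hmem x hx
    rw [h t ht]
    rw [abs_le] at ht
    refine ⟨fun v ↦ ?_, by simp; ring, fun v hv ↦ ?_⟩
    · simp only [Finsupp.add_apply, Finsupp.single_apply]
      split_ifs <;> linarith
    · by_cases hva : a = v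
      · exact hva ▸ hae.trans e.bdry_subset_cls
      · by_cases hvb : b = v
        · exact hvb ▸ hbe.trans e.bdry_subset_cls
        · simp [hva, hvb] at hv
  · have hapex : apex e = Finsupp.single ⟨e, he⟩ 1 := apex_of_ne ⟨e, he⟩
    rcases bary_cases hC e hx with h | ⟨t, ht0, ht1, f, hf, hfe, y, hy, h⟩
    · rw [h, hapex]
      refine ⟨fun v ↦ ?_, by simp, fun v hv ↦ ?_⟩
      · rw [Finsupp.single_apply]
        split_ifs <;> norm_num
      · rw [Finsupp.single_apply] at hv
        by_cases hva : ⟨e, he⟩ = v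
        · rw [← hva]
        · simp [hva] at hv
    · obtain ⟨h1, h2, h3⟩ := ih f.1 hf f rfl y (Cell.opn_subset_cls _ hy)
      rw [h, hapex]
      refine ⟨fun v ↦ ?_, by simp [h2], fun v hv ↦ ?_⟩
      · have := h1 v
        have := mul_nonneg ht0.le this
        simp only [Finsupp.add_apply, Finsupp.smul_apply, Finsupp.single_apply, smul_eq_mul]
        split_ifs <;> linarith
      · by_cases hva : ⟨e, he⟩ = v
        · rw [← hva]
        · refine (h3 v fun h0 ↦ hv ?_).trans (hfe.trans e.bdry_subset_cls)
          simp [hva, h0]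

lemma bary_nonneg {x : X} (hx : x ∈ C) (v : Vertex C) : 0 ≤ bary C x v := by
  obtain ⟨e, he⟩ := Cell.exists_mem_opn hx
  exact (bary_nonneg_mass hC e x (e.opn_subset_cls he)).1 v

lemma mass_bary {x : X} (hx : x ∈ C) : mass (bary C x) = 1 := by
  obtain ⟨e, he⟩ := Cell.exists_mem_opn hx
  exact (bary_nonneg_mass hC e x (e.opn_subset_cls he)).2.1

lemma bary_le_one {x : X} (hx : x ∈ C) (v : Vertex C) : bary C x v ≤ 1 :=
  mass_bary hC hx ▸ le_mass (bary_nonneg hC hx) v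

lemma cls_subset_of_bary_ne_zero {e : Cell C} {x : X} (hx : x ∈ e.cls) {v : Vertex C}
    (hv : bary C x v ≠ 0) : v.1.cls ⊆ e.cls :=
  (bary_nonneg_mass hC e x hx).2.2 v hv

lemma bary_eq_zero_of_lt {e : Cell C} {x : X} (hx : x ∈ e.cls) {v : Vertex C} (hv : e.1 < v.1.1) :
    bary C x v = 0 := by
  by_contra h
  rcases Cell.eq_or_lt_of_subset (cls_subset_of_bary_ne_zero hC hx h) with h' | h'
  · rw [h'] at hv
    exact hv.false
  · exact hv.not_gt h'

lemma support_bary_nonempty {x : X} (hx : x ∈ C) : (bary C x).support.Nonempty := by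
  rw [Finsupp.support_nonempty_iff]
  intro h
  have := mass_bary hC hx
  simp [h] at this

/-- Coning adds at most one vertex and raises the dimension by at least one. The bound determines
the dimension of the Euclidean space needed. -/
lemma card_support_bary_le (e : Cell C) : ∀ x ∈ e.cls, (bary C x).support.card ≤ e.1 + 1 := by
  classical
  induction hn : e.1 using Nat.strong_induction_on generalizing e with
  | _ n ih =>
  subst hn
  intro x hx
  by_cases he : e.1 = 1
  · obtain ⟨a, b, -, -, -, hae, hbe, hmem, h⟩ := exists_ends_of_mem hC he
    obtain ⟨t, ht, rfl⟩ := hmem x hx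
    rw [h t ht, he]
    calc _ ≤ (({a} : Finset (Vertex C)) ∪ {b}).card := Finset.card_le_card
          (Finsupp.support_add.trans (Finset.union_subset_union
            Finsupp.support_single_subset Finsupp.support_single_subset))
      _ ≤ 1 + 1 := (Finset.card_union_le _ _).trans (by simp)
  · have hapex : apex e = Finsupp.single ⟨e, he⟩ 1 := apex_of_ne ⟨e, he⟩
    rcases bary_cases hC e hx with h | ⟨t, ht0, ht1, f, hf, hfe, y, hy, h⟩
    · rw [h, hapex]
      exact (Finset.card_le_card Finsupp.support_single_subset).trans (by simp)
    · have := ih f.1 hf f rfl y (Cell.opn_subset_cls _ hy)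
      rw [h, hapex]
      calc _ ≤ (({⟨e, he⟩} : Finset (Vertex C)) ∪ (bary C y).support).card := Finset.card_le_card
            (Finsupp.support_add.trans (Finset.union_subset_union
              (Finsupp.support_smul.trans Finsupp.support_single_subset) Finsupp.support_smul))
        _ ≤ _ := (Finset.card_union_le _ _).trans (by simp; omega)

/-- The coordinate of a point of a closed cell with respect to the centre of the cell. -/
lemma bary_map_self (v : Vertex C) {u : Fin v.1.1 → ℝ} (hu : ‖u‖ ≤ 1) :
    bary C (v.1.map u) v = 1 - ‖u‖ := by
  rw [bary_map _ hu, apex_of_ne]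
  rcases eq_or_ne u 0 with rfl | h0
  · simp
  · obtain ⟨f, hf, hxf, hfe⟩ :=
      Cell.exists_cls_subset_bdry hC (v.1.map_mem_bdry (norm_normalize h0))
    simp [bary_eq_zero_of_lt hC (f.opn_subset_cls hxf) hf]

/-- Every point with barycentric coordinates supported in the carrier of a point of a closed cell
is attained in this closed cell. -/
lemma exists_bary_eq (e : Cell C) : ∀ x ∈ e.cls, ∀ p : Vertex C →₀ ℝ, (∀ v, 0 ≤ p v) →
    mass p = 1 → p.support ⊆ (bary C x).support → ∃ y ∈ e.cls, bary C y = p := by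
  classical
  induction hn : e.1 using Nat.strong_induction_on generalizing e with
  | _ n ih =>
  subst hn
  intro x hx p hp hp1 hpx
  by_cases he : e.1 = 1
  · obtain ⟨a, b, hab, -, -, hae, hbe, hmem, h⟩ := exists_ends_of_mem hC he
    obtain ⟨t, ht, rfl⟩ := hmem x hx
    have hpab : p = Finsupp.single a (p a) + Finsupp.single b (p b) := by
      ext v
      by_cases hva : a = v
      · simp [← hva, hab.symm]
      · by_cases hvb : b = v
        · simp [← hvb, hab]
        · simp only [Finsupp.add_apply, Finsupp.single_apply, hva, hvb, if_false, add_zero]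
          rw [← Finsupp.notMem_support_iff]
          intro hv
          have := hpx hv
          simp [h t ht, hva, hvb] at this
    have hm : p a + p b = 1 := by
      rw [hpab] at hp1
      simpa using hp1
    -- The parameter `t = p b - p a` solves `(1 - t) / 2 = p a` and `(1 + t) / 2 = p b`.
    have hs : |p b - p a| ≤ 1 := abs_le.2 ⟨by linarith [hp a, hp b], by linarith [hp a, hp b]⟩
    refine ⟨_, e.map_mem_cls (u := fun _ ↦ p b - p a) (by rwa [norm_const he]), ?_⟩
    rw [h _ hs, hpab]
    congr 2 <;> simp [hab, hab.symm] <;> linarith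
  · set c : Vertex C := ⟨e, he⟩
    have hapex : apex e = Finsupp.single c 1 := apex_of_ne c
    have hsplit : Finsupp.single c (p c) + p.erase c = p := Finsupp.single_add_erase c p
    have hmass : p c + mass (p.erase c) = 1 := by
      rw [← hp1, ← congrArg mass hsplit]
      simp
    have herase : ∀ v, 0 ≤ p.erase c v := fun v ↦ by
      rw [Finsupp.erase_apply]
      split_ifs <;> simp [hp]
    by_cases hpc : p c = 1
    · refine ⟨e.map 0, e.map_mem_cls (by simp), ?_⟩
      rw [bary_map_zero, hapex, ← hsplit, eq_zero_of_mass herase (by linarith), hpc, add_zero]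
    · have hlt : 0 < 1 - p c := by
        have := le_mass hp c
        rw [hp1] at this
        exact sub_pos.2 (lt_of_le_of_ne this hpc)
      rcases bary_cases hC e hx with h | ⟨t, ht0, ht1, f, hf, hfe, y, hy, h⟩
      · have : p.erase c = 0 := by
          ext v
          by_cases hvc : v = c
          · simp [hvc]
          · rw [Finsupp.erase_ne hvc, Finsupp.zero_apply, ← Finsupp.notMem_support_iff]
            intro hv
            have := hpx hv
            rw [h, hapex] at this
            exact hvc (Finset.mem_singleton.1 (Finsupp.support_single_subset this))
        rw [this, map_zero] at hmass
        linarith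
      -- Drop the apex weight, renormalize, realize the result on the boundary by induction, and
      -- then move along the radius to distance `1 - p c` from the centre.
      · obtain ⟨z, hz, hzq⟩ := ih f.1 hf f rfl y (f.opn_subset_cls hy)
          ((1 - p c)⁻¹ • p.erase c) (fun v ↦ mul_nonneg (inv_nonneg.2 hlt.le) (herase v))
          (by rw [map_smul, show mass (p.erase c) = 1 - p c by linarith, smul_eq_mul,
            inv_mul_cancel₀ hlt.ne'])
          (fun v hv ↦ by
            have hv := Finsupp.support_smul hv
            rw [Finsupp.support_erase, Finset.mem_erase] at hv
            have := hpx hv.2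
            rw [h, hapex, Finsupp.mem_support_iff] at this
            rw [Finsupp.mem_support_iff]
            intro h0
            simp [Ne.symm hv.1, h0] at this)
        obtain ⟨u, hu, rfl⟩ := Cell.exists_of_mem_bdry (hfe hz)
        refine ⟨e.map ((1 - p c) • u), e.map_mem_cls ?_, ?_⟩
        · rw [norm_smul, hu, mul_one, Real.norm_of_nonneg hlt.le]
          linarith [hp c]
        · rw [bary_map_smul e hu hlt.le (by linarith [hp c]), hzq, hapex, smul_smul,
            mul_inv_cancel₀ hlt.ne', one_smul, sub_sub_cancel, Finsupp.smul_single, smul_eq_mul,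
            mul_one, hsplit]

end Barycentric

/-! ### Injectivity and continuity of the coordinates. -/

section Barycentric

variable {X : Type u} [TopologicalSpace X] {C : Set X} [CWComplex C]
variable (hC : IsRegular C)
include hC

lemma bary_ne_zero_of_mem_opn (v : Vertex C) {x : X} (hx : x ∈ v.1.opn) : bary C x v ≠ 0 := by
  obtain ⟨u, hu, rfl⟩ := Cell.exists_of_mem_opn hx
  rw [bary_map_self hC v hu.le]
  linarith

/-- Equality would make `e` a 0-cell in the closure of the edge `f`, so `x` has a single nonzero
weight, whereas an interior point of an edge has positive weight at both ends. -/
lemma bary_ne_of_edge {e f : Cell C} (he : e.1 ≠ 1) (hf : f.1 = 1) {x y : X} (hx : x ∈ e.opn)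
    (hy : y ∈ f.opn) : bary C x ≠ bary C y := by
  intro h
  obtain ⟨a, b, hab, ha, hb, -, -, hmem, hbary⟩ := exists_ends_of_mem hC hf
  have hne := bary_ne_zero_of_mem_opn hC ⟨e, he⟩ hx
  rw [h] at hne
  have he0 : e.1 = 0 := by
    rcases Cell.eq_or_lt_of_subset
      (cls_subset_of_bary_ne_zero hC (f.opn_subset_cls hy) hne) with h' | h'
    · exact absurd (congrArg Sigma.fst h' |>.trans hf) he
    · simp only at h'
      omega
  obtain ⟨u, hu, rfl⟩ := Cell.exists_of_mem_opn hy
  obtain ⟨t, rfl⟩ := eq_const hf u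
  rw [norm_const hf] at hu
  have hx1 := bary_of_dim_zero ⟨e, he⟩ he0 (e.opn_subset_cls hx)
  rw [h, hbary t hu.le] at hx1
  rw [abs_lt] at hu
  have hA := DFunLike.congr_fun hx1 a
  have hB := DFunLike.congr_fun hx1 b
  classical
  simp only [Finsupp.add_apply, Finsupp.single_apply, hab, hab.symm, if_true, if_false] at hA hB
  split_ifs at hA hB <;> linarith

/-- The open cells agree: edges because they share two ends, other cells because each centre has
nonzero weight at the point of the other cell, so each closure contains the other. Inside a cell
that is not an edge the apex weight gives the radius; the induction hypothesis and injectivity on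
the sphere give the direction. -/
lemma eq_of_bary_eq (e : Cell C) : ∀ x ∈ e.opn, ∀ y ∈ C, bary C x = bary C y → x = y := by
  induction hn : e.1 using Nat.strong_induction_on generalizing e with
  | _ n ih =>
  subst hn
  intro x hx y hy h
  obtain ⟨f, hyf⟩ := Cell.exists_mem_opn hy
  by_cases he : e.1 = 1
  · by_cases hf : f.1 = 1
    swap
    · exact absurd h.symm (bary_ne_of_edge hC hf he hyf hx)
    obtain ⟨a, b, hab, ha, hb, hae, hbe, -, hbary⟩ := exists_ends_of_mem hC he
    have hef : e = f := by
      obtain ⟨u, hu, rfl⟩ := Cell.exists_of_mem_opn hx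
      obtain ⟨t, rfl⟩ := eq_const he u
      rw [norm_const he] at hu
      rw [hbary t hu.le] at h
      rw [abs_lt] at hu
      have haf : a.1.cls ⊆ f.cls := cls_subset_of_bary_ne_zero hC (f.opn_subset_cls hyf) (by
        rw [← h]
        simp only [Finsupp.add_apply, Finsupp.single_eq_same, Finsupp.single_eq_of_ne hab, add_zero]
        linarith)
      have hbf : b.1.cls ⊆ f.cls := cls_subset_of_bary_ne_zero hC (f.opn_subset_cls hyf) (by
        rw [← h]
        simp only [Finsupp.add_apply, Finsupp.single_eq_same, Finsupp.single_eq_of_ne hab.symm,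
          zero_add]
        linarith)
      have hao := a.1.map_zero_mem_opn
      have hbo := b.1.map_zero_mem_opn
      refine Cell.eq_of_two_mem hC he hf (fun h' ↦ hab (Subtype.ext ?_))
        ⟨e.bdry_subset_cls (hae (a.1.opn_subset_cls hao)), haf (a.1.opn_subset_cls hao)⟩
        ⟨e.bdry_subset_cls (hbe (b.1.opn_subset_cls hbo)), hbf (b.1.opn_subset_cls hbo)⟩
      rw [h'] at hao
      exact Cell.eq_of_mem_opn hao hbo
    subst hef
    obtain ⟨u, hu, rfl⟩ := Cell.exists_of_mem_opn hx
    obtain ⟨t, rfl⟩ := eq_const he u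
    obtain ⟨u', hu', rfl⟩ := Cell.exists_of_mem_opn hyf
    obtain ⟨s, rfl⟩ := eq_const he u'
    rw [norm_const he] at hu hu'
    rw [hbary t hu.le, hbary s hu'.le] at h
    have := DFunLike.congr_fun h a
    simp only [Finsupp.add_apply, Finsupp.single_eq_same, Finsupp.single_eq_of_ne hab,
      add_zero] at this
    rw [show t = s by linarith]
  · by_cases hf : f.1 = 1
    · exact absurd h (bary_ne_of_edge hC he hf hx hyf)
    have hef : e = f := by
      have h1 := bary_ne_zero_of_mem_opn hC ⟨e, he⟩ hx
      have h2 := bary_ne_zero_of_mem_opn hC ⟨f, hf⟩ hyf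
      rw [h] at h1
      rw [← h] at h2
      have h1 := Cell.eq_or_lt_of_subset (cls_subset_of_bary_ne_zero hC (f.opn_subset_cls hyf) h1)
      have h2 := Cell.eq_or_lt_of_subset (cls_subset_of_bary_ne_zero hC (e.opn_subset_cls hx) h2)
      rcases h1 with h1 | h1
      · exact h1
      · rcases h2 with h2 | h2
        · exact h2.symm
        · exact absurd h1 h2.not_gt
    subst hef
    obtain ⟨u, hu, rfl⟩ := Cell.exists_of_mem_opn hx
    obtain ⟨w, hw, rfl⟩ := Cell.exists_of_mem_opn hyf
    have huw : ‖u‖ = ‖w‖ := by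
      have := DFunLike.congr_fun h ⟨e, he⟩
      rw [bary_map_self hC ⟨e, he⟩ hu.le, bary_map_self hC ⟨e, he⟩ hw.le] at this
      linarith
    rcases eq_or_ne u 0 with rfl | hu0
    · rw [norm_zero] at huw
      rw [norm_eq_zero.1 huw.symm]
    · have hw0 : w ≠ 0 := by
        rintro rfl
        exact hu0 (by simpa using huw)
      have hnu := norm_ne_zero_iff.2 hu0
      rw [bary_map e hu.le, bary_map e hw.le, huw] at h
      have h := smul_right_injective _ (huw ▸ hnu) (add_left_cancel h)
      rw [← huw] at h
      have hw1 : ‖‖u‖⁻¹ • w‖ = 1 := huw ▸ norm_normalize hw0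
      obtain ⟨g, hg, hxg⟩ := Cell.exists_lt_of_mem_bdry (e.map_mem_bdry (norm_normalize hu0))
      have := ih g.1 hg g rfl _ hxg _ (e.cls_subset (e.map_mem_cls hw1.le)) h
      have := Cell.injOn_map_sphere hC e (by simpa using norm_normalize hu0)
        (by simpa using hw1) this
      rw [smul_right_injective _ (inv_ne_zero hnu) this]

lemma bary_injOn : InjOn (bary C) C := fun x hx y hy h ↦ by
  obtain ⟨e, he⟩ := Cell.exists_mem_opn hx
  exact eq_of_bary_eq hC e x he y hy h

/-- The coordinates of `y` are attained inside `e.cls`, and injectivity shows that they are attained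
at `y`. This is why closed cells are subcomplexes. -/
lemma mem_cls_of_support_subset {e : Cell C} {x y : X} (hx : x ∈ e.cls) (hy : y ∈ C)
    (h : (bary C y).support ⊆ (bary C x).support) : y ∈ e.cls := by
  obtain ⟨z, hz, hzy⟩ := exists_bary_eq hC e x hx _ (bary_nonneg hC hy) (mass_bary hC hy) h
  rwa [← bary_injOn hC (e.cls_subset hz) hy hzy]

-- The characteristic map is a quotient map from the closed ball onto the closed cell: compact to
-- Hausdorff.
omit hC in
lemma continuousOn_cls {Y : Type*} [TopologicalSpace Y] [T2Space X] {e : Cell C} {f : X → Y}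
    (h : ContinuousOn (f ∘ e.map) (closedBall 0 1)) : ContinuousOn f e.cls := by
  rw [continuousOn_iff_isClosed]
  intro t ht
  obtain ⟨K, hK, hKt⟩ := continuousOn_iff_isClosed.1 h t ht
  refine ⟨e.map '' (K ∩ closedBall 0 1), ?_, ?_⟩
  · exact (((isCompact_closedBall _ _).inter_left hK).image_of_continuousOn
      (e.continuousOn_map.mono inter_subset_right)).isClosed
  · rw [← hKt, Cell.cls_eq]
    ext x
    constructor
    · rintro ⟨hx, u, hu, rfl⟩
      exact ⟨⟨u, ⟨hx, hu⟩, rfl⟩, u, hu, rfl⟩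
    · rintro ⟨⟨u, ⟨hx, hu⟩, rfl⟩, h⟩
      exact ⟨hx, h⟩

-- At the origin the direction `‖u‖⁻¹ • u` has no limit, but `g` is bounded and the factor `‖u‖`
-- tends to 0.
omit hC in
lemma continuousOn_cone {n : ℕ} (c : ℝ) {g : (Fin n → ℝ) → ℝ} (hg : ContinuousOn g (sphere 0 1))
    (h0 : ∀ u ∈ sphere (0 : Fin n → ℝ) 1, |g u| ≤ 1) :
    Continuous fun u : Fin n → ℝ ↦ (1 - ‖u‖) * c + ‖u‖ * g (‖u‖⁻¹ • u) := by
  refine Continuous.add (by fun_prop) (continuous_iff_continuousAt.2 fun u ↦ ?_)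
  rcases eq_or_ne u 0 with rfl | hu
  · rw [ContinuousAt, norm_zero, zero_mul]
    refine squeeze_zero_norm (a := fun u ↦ ‖u‖) (fun u ↦ ?_) (by
      simpa using (continuous_norm (E := Fin n → ℝ)).tendsto 0)
    rcases eq_or_ne u 0 with rfl | hu
    · simp
    · rw [norm_mul, norm_norm]
      exact mul_le_of_le_one_right (norm_nonneg _) (h0 _ (by simpa using norm_normalize hu))
  · refine continuousAt_id.norm.mul ?_
    have hc : ContinuousOn (fun u : Fin n → ℝ ↦ ‖u‖⁻¹ • u) {0}ᶜ :=
      (continuousOn_id.norm.inv₀ fun u hu ↦ norm_ne_zero_iff.2 hu).smul continuousOn_id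
    exact (hg.comp hc fun u hu ↦ by simpa using norm_normalize hu).continuousAt
      (isOpen_compl_singleton.mem_nhds hu)

/-- By induction the coordinate is continuous on the boundary, which is covered by finitely many
closed cells of lower dimension; `continuousOn_cone` extends this over the ball. -/
lemma continuousOn_bary [T2Space X] (v : Vertex C) (e : Cell C) :
    ContinuousOn (fun x ↦ bary C x v) e.cls := by
  induction hn : e.1 using Nat.strong_induction_on generalizing e with
  | _ n ih =>
  subst hn
  have hb : ContinuousOn (fun x ↦ bary C x v) e.bdry := by
    obtain ⟨I, hI, hIe⟩ := e.exists_finset_bdry_subset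
    have h : ContinuousOn (fun x ↦ bary C x v) (⋃ f : I, f.1.cls) :=
      (locallyFinite_of_finite _).continuousOn_iUnion (fun f ↦ f.1.isCompact_cls.isClosed)
        fun f ↦ ih f.1.1 (hI f.1 f.2) f.1 rfl
    refine h.mono (hIe.trans fun x hx ↦ ?_)
    simp only [mem_iUnion] at hx ⊢
    obtain ⟨f, hf, hx⟩ := hx
    exact ⟨⟨f, hf⟩, f.opn_subset_cls hx⟩
  apply continuousOn_cls
  have hs : ContinuousOn (fun u ↦ bary C (e.map u) v) (sphere 0 1) :=
    hb.comp (e.continuousOn_map.mono sphere_subset_closedBall)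
      fun u hu ↦ e.map_mem_bdry (by simpa using hu)
  refine (continuousOn_cone (apex e v) hs fun u hu ↦ ?_).continuousOn.congr fun u hu ↦ ?_
  · have : e.map u ∈ C := e.cls_subset (e.map_mem_cls (by simp at hu; exact hu.le))
    rw [abs_of_nonneg (bary_nonneg hC this v)]
    exact bary_le_one hC this v
  · simp [bary_map e (by simpa using hu)]

end Barycentric

/-! ### The triangulation -/

section Triangulation

variable {X : Type u} [TopologicalSpace X] {C : Set X} [CWComplex C]

variable (C) in
/-- The faces of the conical triangulation: the carriers of the points. -/
def faces : Set (Finset (Vertex C)) := {s | ∃ x ∈ C, (bary C x).support = s}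

/-- The curvilinear simplex spanned by a finite set of vertices. -/
def simplex (s : Finset (Vertex C)) : Set X := {x ∈ C | (bary C x).support ⊆ s}

lemma support_mem_faces {x : X} (hx : x ∈ C) : (bary C x).support ∈ faces C := ⟨x, hx, rfl⟩

lemma mem_simplex_support {x : X} (hx : x ∈ C) : x ∈ simplex (bary C x).support :=
  ⟨hx, Finset.Subset.refl _⟩

lemma bary_map_zero_vertex (v : Vertex C) : bary C (v.1.map 0) = Finsupp.single v 1 := by
  rw [bary_map_zero, apex_of_ne]

lemma map_zero_mem (e : Cell C) : e.map 0 ∈ C := e.cls_subset (e.map_mem_cls (by simp))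

lemma singleton_mem_faces (v : Vertex C) : {v} ∈ faces C :=
  ⟨v.1.map 0, map_zero_mem _, by
    rw [bary_map_zero_vertex, Finsupp.support_single _ one_ne_zero]⟩

variable (hC : IsRegular C)
include hC

lemma simplex_subset_cls {e : Cell C} {x : X} (hx : x ∈ e.cls) :
    simplex (bary C x).support ⊆ e.cls := fun _ hy ↦ mem_cls_of_support_subset hC hx hy.1 hy.2

lemma simplex_subset_bdry {e : Cell C} {x : X} (hx : x ∈ e.bdry) :
    simplex (bary C x).support ⊆ e.bdry := by
  obtain ⟨f, -, hxf, hf⟩ := Cell.exists_cls_subset_bdry hC hx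
  exact (simplex_subset_cls hC (f.opn_subset_cls hxf)).trans hf

lemma simplex_singleton (v : Vertex C) : simplex {v} = {v.1.map 0} := by
  ext x
  constructor
  · rintro ⟨hx, h⟩
    refine bary_injOn hC hx (map_zero_mem _) ?_
    rw [bary_map_zero_vertex]
    obtain ⟨r, hr⟩ := Finsupp.support_subset_singleton'.1 h
    have := mass_bary hC hx
    rw [hr, mass_single] at this
    rw [hr, this]
  · rintro rfl
    exact ⟨map_zero_mem _, by rw [bary_map_zero_vertex]; exact Finsupp.support_single_subset⟩

lemma isRelLowerSet_faces : IsRelLowerSet (faces C) Finset.Nonempty := by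
  classical
  rintro _ ⟨x, hx, rfl⟩
  refine ⟨support_bary_nonempty hC hx, fun t ht htn ↦ ?_⟩
  obtain ⟨e, he⟩ := Cell.exists_mem_opn hx
  have hcard : (t.card : ℝ) ≠ 0 := by simpa using htn.ne_empty
  -- The barycentre of `t` has support exactly `t`, and it is attained.
  let p : Vertex C →₀ ℝ := Finsupp.indicator t fun _ _ ↦ (t.card : ℝ)⁻¹
  have hp (v) : p v = if v ∈ t then (t.card : ℝ)⁻¹ else 0 := by simp [p, Finsupp.indicator_apply]
  have hsupp : p.support = t := by
    ext v
    simp [hp, htn.ne_empty]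
  obtain ⟨y, hy, hyp⟩ := exists_bary_eq hC e x (e.opn_subset_cls he) p
    (fun v ↦ by rw [hp]; split_ifs <;> positivity)
    (by
      rw [mass_apply, Finsupp.sum, hsupp, Finset.sum_congr rfl fun v hv ↦ (hp v).trans (if_pos hv)]
      simp [hcard]) (hsupp.subset.trans ht)
  exact ⟨y, e.cls_subset hy, hyp ▸ hsupp⟩

omit hC in
lemma simplex_subset_iff {s : Finset (Vertex C)} (hs : s ∈ faces C) (A : Set X)
    (h : ∀ x ∈ A, simplex (bary C x).support ⊆ A) :
    simplex s ⊆ A ↔ ∃ x ∈ A, (bary C x).support = s := by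
  constructor
  · intro hsA
    obtain ⟨x, hx, rfl⟩ := hs
    exact ⟨x, hsA (mem_simplex_support hx), rfl⟩
  · rintro ⟨x, hx, rfl⟩
    exact h x hx

omit hC in
lemma isUnionOfSimplices {A : Set X} (hA : A ⊆ C) (h : ∀ x ∈ A, simplex (bary C x).support ⊆ A) :
    IsUnionOfSimplices (faces C) simplex A := by
  ext x
  simp only [mem_iUnion]
  constructor
  · intro hx
    exact ⟨_, ⟨support_mem_faces (hA hx), h x hx⟩, mem_simplex_support (hA hx)⟩
  · rintro ⟨s, hs, hx⟩
    exact hs.2 hx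

/-- The triangulation of a regular cell complex by the carriers of its points is conical. -/
lemma isConical_faces : IsConical C (faces C) simplex where
  closedCell_subcomplex n e :=
    isUnionOfSimplices (Cell.cls_subset ⟨n, e⟩) fun _ hx ↦ simplex_subset_cls (e := ⟨n, e⟩) hC hx
  cellFrontier_subcomplex n e :=
    isUnionOfSimplices ((Cell.bdry_subset_cls ⟨n, e⟩).trans (Cell.cls_subset ⟨n, e⟩))
      fun _ hx ↦ simplex_subset_bdry (e := ⟨n, e⟩) hC hx
  zero_cell e := by
    let v : Vertex C := ⟨⟨0, e⟩, zero_ne_one⟩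
    exact ⟨{v}, singleton_mem_faces v, by simp, (simplex_singleton hC v).trans
      (Cell.cls_eq_singleton (e := v.1) rfl).symm⟩
  one_cell j := by
    classical
    let e : Cell C := ⟨1, j⟩
    obtain ⟨a, b, hab, -, -, -, -, hmem, h⟩ := exists_ends_of_mem hC (e := e) rfl
    -- The midpoint of the edge witnesses that its two ends span a face.
    have h0 : (bary C (e.map fun _ ↦ 0)).support = {a, b} := by
      rw [h 0 (by simp)]
      ext v
      simp only [Finsupp.mem_support_iff, Finsupp.add_apply, Finsupp.single_apply,
        Finset.mem_insert, Finset.mem_singleton, eq_comm (a := v)]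
      split_ifs <;> simp [*]
    have hm : (e.map fun _ ↦ 0) ∈ e.cls := e.map_mem_cls (by rw [norm_const rfl]; simp)
    refine ⟨{a, b}, ⟨_, e.cls_subset hm, h0⟩, Finset.card_pair hab, ?_⟩
    refine (h0 ▸ simplex_subset_cls hC hm : simplex {a, b} ⊆ e.cls).antisymm
      fun x (hx : x ∈ e.cls) ↦ ⟨e.cls_subset hx, ?_⟩
    obtain ⟨t, ht, rfl⟩ := hmem x hx
    rw [h t ht]
    exact Finsupp.support_add.trans (Finset.union_subset_union
            Finsupp.support_single_subset Finsupp.support_single_subset)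
  cone n e hn := by
    classical
    let c : Vertex C := ⟨⟨n, e⟩, by simp; omega⟩
    have hbc : c.1.bdry ⊆ C := c.1.bdry_subset_cls.trans c.1.cls_subset
    refine ⟨c, ?_, ?_⟩
    · rw [simplex_singleton hC c, singleton_subset_iff]
      exact c.1.map_zero_mem_opn
    -- Strictly between centre and boundary both cone weights are nonzero, so the carrier is the
    -- cone over the carrier of the boundary point.
    have hinsert (u : Fin c.1.1 → ℝ) (hu : ‖u‖ = 1) (t : ℝ) (ht0 : 0 < t) (ht1 : t < 1) :
        (bary C (c.1.map (t • u))).support = insert c (bary C (c.1.map u)).support := by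
      have hcu := bary_map_self hC c hu.le
      rw [hu, sub_self] at hcu
      rw [bary_map_smul _ hu ht0.le ht1.le, apex_of_ne]
      ext v
      by_cases hv : v = c
      · simp [hv, hcu, sub_ne_zero, ht1.ne']
      · simp [hv, ht0.ne', Finsupp.single_eq_of_ne hv]
    change {s ∈ faces C | simplex s ⊆ c.1.cls} = {s ∈ faces C | simplex s ⊆ c.1.bdry} ∪ {{c}} ∪
      {s | ∃ t ∈ faces C, simplex t ⊆ c.1.bdry ∧ (s : Set (Vertex C)) = insert c (t : Set _)}
    ext s
    constructor
    · rintro ⟨hs, hsc⟩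
      obtain ⟨x, hx, rfl⟩ := (simplex_subset_iff hs c.1.cls
        fun _ ↦ simplex_subset_cls hC).1 hsc
      rcases Cell.mem_bdry_or_mem_opn hx with hxb | hxo
      · exact .inl (.inl ⟨hs, simplex_subset_bdry hC hxb⟩)
      obtain ⟨u, hu, rfl⟩ := Cell.exists_of_mem_opn hxo
      rcases eq_or_ne u 0 with rfl | h0
      · left; right
        rw [mem_singleton_iff, bary_map_zero_vertex, Finsupp.support_single _ one_ne_zero]
      · right
        have hb := c.1.map_mem_bdry (norm_normalize h0)
        refine ⟨_, support_mem_faces (hbc hb), simplex_subset_bdry hC hb, ?_⟩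
        have := hinsert _ (norm_normalize h0) ‖u‖ (norm_pos_iff.2 h0) hu
        rw [smul_smul, mul_inv_cancel₀ (norm_ne_zero_iff.2 h0), one_smul] at this
        rw [this, Finset.coe_insert]
    · rintro ((⟨hs, h⟩ | rfl) | ⟨t, ht, htb, hst⟩)
      · exact ⟨hs, h.trans c.1.bdry_subset_cls⟩
      · refine ⟨singleton_mem_faces c, ?_⟩
        rw [simplex_singleton hC, singleton_subset_iff]
        exact c.1.opn_subset_cls c.1.map_zero_mem_opn
      · obtain ⟨x, hx, rfl⟩ := (simplex_subset_iff ht c.1.bdry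
          fun _ ↦ simplex_subset_bdry hC).1 htb
        obtain ⟨u, hu, rfl⟩ := Cell.exists_of_mem_bdry hx
        have hm : c.1.map ((1 / 2 : ℝ) • u) ∈ c.1.cls :=
          c.1.map_mem_cls (by rw [norm_smul, hu]; norm_num)
        have := hinsert u hu (1 / 2) (by norm_num) (by norm_num)
        rw [← Finset.coe_insert, Finset.coe_inj] at hst
        rw [hst, ← this]
        exact ⟨support_mem_faces (c.1.cls_subset hm), simplex_subset_cls hC hm⟩

variable [T2Space X]

/-- A simplex is cut out of a closed cell by the vanishing of coordinates, which are continuous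
there. -/
lemma isCompact_simplex {s : Finset (Vertex C)} (hs : s ∈ faces C) :
    IsCompact (simplex s : Set X) := by
  obtain ⟨x, hx, rfl⟩ := hs
  obtain ⟨e, he⟩ := Cell.exists_mem_opn hx
  have h : simplex (bary C x).support =
      e.cls ∩ ⋂ v : {v // v ∉ (bary C x).support}, e.cls ∩ (fun y ↦ bary C y v.1) ⁻¹' {0} := by
    ext y
    simp only [mem_inter_iff, mem_iInter]
    constructor
    · intro hy
      have := simplex_subset_cls hC (e.opn_subset_cls he) hy
      refine ⟨this, fun v ↦ ⟨this, ?_⟩⟩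
      have := mt (@hy.2 v.1) v.2
      simpa using this
    · rintro ⟨hy, h⟩
      refine ⟨e.cls_subset hy, fun v hv ↦ by_contra fun hv' ↦ ?_⟩
      exact Finsupp.mem_support_iff.1 hv (h ⟨v, hv'⟩).2
  rw [h]
  exact e.isCompact_cls.inter_right (isClosed_iInter fun v ↦
    (continuousOn_bary hC v.1 e).preimage_isClosed_of_isClosed e.isCompact_cls.isClosed
      isClosed_singleton)

lemma continuousOn_bary_simplex {s : Finset (Vertex C)} (hs : s ∈ faces C) (v : Vertex C) :
    ContinuousOn (fun x ↦ bary C x v) (simplex s) := by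
  obtain ⟨x, hx, rfl⟩ := hs
  obtain ⟨e, he⟩ := Cell.exists_mem_opn hx
  exact (continuousOn_bary hC v e).mono (simplex_subset_cls hC (e.opn_subset_cls he))

omit hC in
lemma continuous_of_continuousOn_cls {Y : Type*} [TopologicalSpace Y] {f : C → Y}
    (h : ∀ e : Cell C, ContinuousOn f (Subtype.val ⁻¹' e.cls)) : Continuous f := by
  have hcl : IsClosedEmbedding (Subtype.val : C → X) :=
    RelCWComplex.isClosed.isClosedEmbedding_subtypeVal
  rw [continuous_iff_isClosed]
  intro A hA
  rw [hcl.isClosed_iff_image_isClosed, CWComplex.closed C _ (Subtype.coe_image_subset _ _)]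
  intro n j
  let e : Cell C := ⟨n, j⟩
  change IsClosed (Subtype.val '' (f ⁻¹' A) ∩ e.cls)
  rw [← image_inter_preimage, inter_comm]
  exact hcl.isClosedMap _ ((h e).preimage_isClosed_of_isClosed
    (e.isCompact_cls.isClosed.preimage continuous_subtype_val) hA)

/-- A function on a regular cell complex is continuous if it is continuous on the simplices. -/
lemma continuous_of_continuousOn_simplex {Y : Type*} [TopologicalSpace Y] {f : C → Y}
    (h : ∀ s ∈ faces C, ContinuousOn f (Subtype.val ⁻¹' simplex s)) : Continuous f := by
  refine continuous_of_continuousOn_cls fun e ↦ ?_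
  -- The carriers of points of `e.cls` use only these vertices, so finitely many compact simplices
  -- cover the closed cell.
  have hfin : {v : Vertex C | v.1.cls ⊆ e.cls}.Finite :=
    e.finite_subset_cls.preimage Subtype.val_injective.injOn
  have : Finite {s : Finset (Vertex C) // s ∈ faces C ∧ s ⊆ hfin.toFinset} :=
    ((Finset.finite_toSet hfin.toFinset.powerset).subset fun s hs ↦ by simpa using hs.2).to_subtype
  have hU : ContinuousOn f (⋃ s : {s : Finset (Vertex C) // s ∈ faces C ∧ s ⊆ hfin.toFinset},
      Subtype.val ⁻¹' simplex s.1) :=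
    (locallyFinite_of_finite _).continuousOn_iUnion
      (fun s ↦ (isCompact_simplex hC s.2.1).isClosed.preimage continuous_subtype_val)
      fun s ↦ h s.1 s.2.1
  refine hU.mono fun x hx ↦ mem_iUnion.2 ⟨⟨(bary C x).support, support_mem_faces x.2, ?_⟩,
    mem_simplex_support x.2⟩
  intro v hv
  simpa using cls_subset_of_bary_ne_zero hC hx (Finsupp.mem_support_iff.1 hv)

end Triangulation

/-- Closed subsets of `K` have compact, hence closed, images. -/
lemma continuousOn_leftInverse_image {X Y : Type*} [TopologicalSpace X] [TopologicalSpace Y]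
    [T2Space Y] {K : Set X} (hK : IsCompact K) {f : X → Y} (hf : ContinuousOn f K) {g : Y → X}
    (hg : ∀ x ∈ K, g (f x) = x) : ContinuousOn g (f '' K) := by
  rw [continuousOn_iff_isClosed]
  intro t ht
  refine ⟨f '' (K ∩ t), ((hK.inter_right ht).image_of_continuousOn
    (hf.mono inter_subset_left)).isClosed, ?_⟩
  ext y
  constructor
  · rintro ⟨hy, x, hx, rfl⟩
    rw [mem_preimage, hg x hx] at hy
    exact ⟨⟨x, ⟨hx, hy⟩, rfl⟩, x, hx, rfl⟩
  · rintro ⟨⟨x, ⟨hx, hxt⟩, rfl⟩, h⟩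
    refine ⟨?_, h⟩
    rwa [mem_preimage, hg x hx]

/-! ### Maps into and out of the weak topology. -/

section Realization

lemma continuous_to_realization {V : Type v} {K : AbstractSimplicialComplex V} {Z : Type*}
    [TopologicalSpace Z] {s : Finset V} (hs : s ∈ K.faces) {g : Z → Realization K}
    (hg : ∀ z, g z ∈ closedSimplex K s) (hc : ∀ a, Continuous fun z ↦ (g z).1 a) :
    Continuous g := by
  refine continuous_iSup_rng (i := ⟨s, hs⟩) ?_
  refine continuous_def.2 fun U hU ↦ ?_
  rw [isOpen_coinduced, isOpen_induced_iff] at hU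
  obtain ⟨W, hW, hWU⟩ := hU
  have : g ⁻¹' U = (fun z a ↦ (g z).1 a) ⁻¹' W := by
    ext z
    exact (Set.ext_iff.1 hWU ⟨g z, hg z⟩).symm
  rw [this]
  exact hW.preimage (continuous_pi hc)

/-- Factoring through a function `G` of all coordinate systems moves the continuity test into the
product space `V → ℝ`; the values of `G` off the simplices are irrelevant. -/
lemma continuous_from_realization {V : Type v} {K : AbstractSimplicialComplex V} {Y : Type*}
    [TopologicalSpace Y] {g : Realization K → Y} (G : (V → ℝ) → Y)
    (hG : ∀ s ∈ K.faces,
      ContinuousOn G ((fun (p : Realization K) (a : V) ↦ p.1 a) '' closedSimplex K s))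
    (hg : ∀ p, g p = G fun a ↦ p.1 a) : Continuous g := by
  refine continuous_iSup_dom.2 fun s ↦ continuous_coinduced_dom.2 ?_
  refine @continuous_def _ _ (TopologicalSpace.induced _ _) _ _ |>.2 fun U hU ↦ ?_
  obtain ⟨W, hW, hWU⟩ := (continuousOn_iff'.1 (hG s.1 s.2)) U hU
  refine isOpen_induced_iff.2 ⟨W, hW, ?_⟩
  ext p
  have := Set.ext_iff.1 hWU (fun a ↦ p.1.1 a)
  have hm : (fun a ↦ p.1.1 a) ∈
    (fun (p : Realization K) (a : V) ↦ p.1 a) '' closedSimplex K s.1 := ⟨p.1, p.2, rfl⟩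
  simp only [mem_inter_iff, hm, and_true, mem_preimage] at this
  simp only [mem_preimage, Function.comp_apply, hg]
  exact this.symm

end Realization

/-! ### The homeomorphism with the realization. -/

section Weak

variable {X : Type u} [TopologicalSpace X] {C : Set X} [CWComplex C]
variable (hC : IsRegular C)

/-- The abstract simplicial complex of the conical triangulation. -/
def complex : AbstractSimplicialComplex (Vertex C) where
  faces := faces C
  isRelLowerSet_faces := isRelLowerSet_faces hC
  singleton_mem := singleton_mem_faces

/-- The point of the realization with the barycentric coordinates of a given point. -/
def toRealization (x : C) : Realization (complex hC) :=
  ⟨bary C x, bary_nonneg hC x.2, (mass_apply _).symm.trans (mass_bary hC x.2),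
    support_mem_faces x.2⟩

lemma toRealization_bijective : Function.Bijective (toRealization hC) := by
  constructor
  · intro x y h
    exact Subtype.ext (bary_injOn hC x.2 y.2 (congrArg Subtype.val h))
  · rintro ⟨p, hp0, hp1, x, hx, hxp⟩
    obtain ⟨e, he⟩ := Cell.exists_mem_opn hx
    obtain ⟨y, hy, rfl⟩ := exists_bary_eq hC e x (e.opn_subset_cls he) p hp0
      ((mass_apply p).trans hp1) hxp.symm.subset
    exact ⟨⟨y, e.cls_subset hy⟩, rfl⟩

variable [T2Space X]

lemma continuous_toRealization : Continuous (toRealization hC) := by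
  refine continuous_of_continuousOn_simplex hC fun s hs ↦ ?_
  rw [continuousOn_iff_continuous_domRestrict]
  refine continuous_to_realization (s := s) hs (fun z ↦ z.2.2) fun v ↦ ?_
  exact continuousOn_iff_continuous_domRestrict.1
    ((continuousOn_bary_simplex hC hs v).comp (s := Subtype.val ⁻¹' simplex s)
      continuous_subtype_val.continuousOn fun _ h ↦ h)

include hC in
lemma hasConicalTriangulation : HasConicalTriangulation C := by
  let E := Equiv.ofBijective _ (toRealization_bijective hC)
  have hbary (p) : bary C (E.symm p) = p.1 := congrArg Subtype.val (E.apply_symm_apply p)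
  have himage (s : Finset (Vertex C)) :
      (fun p ↦ (E.symm p : X)) '' closedSimplex (complex hC) s = simplex s := by
    ext x
    constructor
    · rintro ⟨p, hp, rfl⟩
      refine ⟨(E.symm p).2, ?_⟩
      rw [hbary]
      exact hp
    · rintro ⟨hx, h⟩
      exact ⟨E ⟨x, hx⟩, h, by simp⟩
  have hcont : Continuous E.symm := by
    refine continuous_induced_rng.2 ?_
    -- The inverse is extended to all coordinate functions by `Function.invFunOn`, which needs a
    -- point of `X`; hence the separate empty case.
    cases isEmpty_or_nonempty C with
    | inl h =>
      have : IsEmpty (Realization (complex hC)) := E.symm.isEmpty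
      exact continuous_of_const fun x ↦ isEmptyElim x
    | inr h =>
    have : Nonempty X := h.map Subtype.val
    have hinv (x) (hx : x ∈ C) :
        Function.invFunOn (fun x v ↦ bary C x v) C (fun v ↦ bary C x v) = x :=
      InjOn.leftInvOn_invFunOn
        (fun x hx y hy h ↦ bary_injOn hC hx hy (DFunLike.coe_injective h)) hx
    refine continuous_from_realization (Function.invFunOn (fun x v ↦ bary C x v) C)
      (fun s hs ↦ ?_) fun p ↦ ?_
    · have := continuousOn_leftInverse_image (isCompact_simplex hC hs)
        (continuousOn_pi.2 fun v ↦ continuousOn_bary_simplex hC hs v) fun x hx ↦ hinv x hx.1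
      rw [← himage, image_image] at this
      simpa only [hbary] using this
    · have := hinv (E.symm p) (E.symm p).2
      simp only [hbary] at this
      exact this.symm
  refine ⟨Vertex C, complex hC, ⟨E.symm, hcont, continuous_toRealization hC⟩, ?_⟩
  change IsConical C (faces C) fun s ↦ (fun p ↦ (E.symm p : X)) '' closedSimplex (complex hC) s
  simp only [himage]
  exact isConical_faces hC

end Weak

/-! ### Euclidean realizations -/

/-! ### General position on the moment curve. -/

section MomentCurve

/-- The points with natural parameters on the moment curve. -/
def momentCurve (m k : ℕ) : EuclideanSpace ℝ (Fin m) :=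
  WithLp.toLp 2 fun i ↦ (k : ℝ) ^ (i.1 + 1)

lemma momentCurve_injective (m : ℕ) (hm : 0 < m) : Function.Injective (momentCurve m) := by
  intro k l h
  have := congrArg (fun x : EuclideanSpace ℝ (Fin m) ↦ x ⟨0, hm⟩) h
  simpa [momentCurve] using this

variable {V : Type v} {m : ℕ}

/-- The linear extension of a map of the vertices to the moment curve. -/
def momentMap (m : ℕ) (enc : V → ℕ) : (V →₀ ℝ) →ₗ[ℝ] EuclideanSpace ℝ (Fin m) :=
  Finsupp.linearCombination ℝ fun v ↦ momentCurve m (enc v)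

lemma momentMap_apply (enc : V → ℕ) (p : V →₀ ℝ) :
    momentMap m enc p = ∑ v ∈ p.support, p v • momentCurve m (enc v) := by
  rw [momentMap, Finsupp.linearCombination_apply, Finsupp.sum]

lemma momentMap_coord (enc : V → ℕ) (p : V →₀ ℝ) (i : Fin m) :
    momentMap m enc p i = ∑ v ∈ p.support, p v * (enc v : ℝ) ^ (i.1 + 1) := by
  simp [momentMap_apply, momentCurve]

/-- The mass gives the power sum with exponent 0 and the coordinates those with exponents 1 to `m`.
With at most `m + 1` distinct nodes the Vandermonde system has only the zero solution. -/
lemma eq_zero_of_momentMap {enc : V → ℕ} (henc : Function.Injective enc) {p : V →₀ ℝ}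
    (h0 : mass p = 0) (h1 : momentMap m enc p = 0) (hcard : p.support.card ≤ m + 1) : p = 0 := by
  let E := p.support.equivFin
  have hsum (g : V → ℝ) : ∑ j, g (E.symm j) = ∑ v ∈ p.support, g v := by
    rw [← Finset.sum_coe_sort p.support g]
    exact Equiv.sum_comp E.symm fun v ↦ g v
  have := Matrix.eq_zero_of_forall_pow_sum_mul_pow_eq_zero
    (f := fun j ↦ (enc (E.symm j) : ℝ)) (v := fun j ↦ p (E.symm j))
    (fun i j h ↦ E.symm.injective (Subtype.ext (henc (Nat.cast_injective h)))) (fun i ↦ by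
      rw [hsum fun v ↦ p v * (enc v : ℝ) ^ (i : ℕ)]
      rcases hi : i.1 with _ | k
      · simpa [mass_apply, Finsupp.sum] using h0
      · have hk : k < m := by have := i.2; omega
        rw [← momentMap_coord enc p ⟨k, hk⟩, h1]
        rfl)
  by_contra hp
  obtain ⟨v, hv⟩ := Finsupp.support_nonempty_iff.2 hp
  have h := congrFun this (E ⟨v, hv⟩)
  simp only [Equiv.symm_apply_apply, Pi.zero_apply] at h
  exact Finsupp.mem_support_iff.1 hv h

lemma eq_of_momentMap_eq {enc : V → ℕ} (henc : Function.Injective enc) {p q : V →₀ ℝ}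
    (h0 : mass p = mass q) (h1 : momentMap m enc p = momentMap m enc q)
    (hcard : p.support.card + q.support.card ≤ m + 1) : p = q := by
  classical
  refine sub_eq_zero.1 (eq_zero_of_momentMap henc (by rw [map_sub, h0, sub_self])
    (by rw [map_sub, h1, sub_self]) ?_)
  exact (Finset.card_le_card Finsupp.support_sub).trans ((Finset.card_union_le _ _).trans hcard)

/-- The embedding of the vertices in the moment curve. -/
def momentEmb (m : ℕ) (hm : 0 < m) (enc : V ↪ ℕ) : V ↪ EuclideanSpace ℝ (Fin m) :=
  enc.trans ⟨momentCurve m, momentCurve_injective m hm⟩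

lemma mem_convexHull_map {E : Type*} [AddCommGroup E] [Module ℝ E] (f : V ↪ E) (s : Finset V)
    (z : E) : z ∈ convexHull ℝ (s.map f : Set E) ↔ ∃ p : V →₀ ℝ, (∀ v, 0 ≤ p v) ∧ mass p = 1 ∧
      p.support ⊆ s ∧ Finsupp.linearCombination ℝ f p = z := by
  classical
  rw [Finset.mem_convexHull']
  constructor
  · rintro ⟨w, hw0, hw1, rfl⟩
    rw [Finset.sum_map] at hw1
    have hsub : (Finsupp.indicator s fun v _ ↦ w (f v)).support ⊆ s :=
      Finsupp.support_indicator_subset _ _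
    refine ⟨Finsupp.indicator s fun v _ ↦ w (f v), fun v ↦ ?_, ?_, hsub, ?_⟩
    · rw [Finsupp.indicator_apply]
      split_ifs with hv
      · exact hw0 _ (Finset.mem_map_of_mem f hv)
      · rfl
    · rw [mass_apply, Finsupp.sum_of_support_subset _ hsub _ (by simp), ← hw1]
      exact Finset.sum_congr rfl fun v hv ↦ by simp [Finsupp.indicator_apply, hv]
    · rw [Finsupp.linearCombination_apply, Finsupp.sum_of_support_subset _ hsub _ (by simp),
        Finset.sum_map]
      exact Finset.sum_congr rfl fun v hv ↦ by simp [Finsupp.indicator_apply, hv]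
  · rintro ⟨p, hp0, hp1, hps, rfl⟩
    have hinv (v : V) : Function.extend f p 0 (f v) = p v := f.injective.extend_apply _ _ _
    refine ⟨Function.extend f p 0, fun y hy ↦ ?_, ?_, ?_⟩
    · obtain ⟨v, -, rfl⟩ := Finset.mem_map.1 hy
      rw [hinv]
      exact hp0 v
    · simp only [Finset.sum_map, hinv]
      rw [← hp1, mass_apply, Finsupp.sum_of_support_subset _ hps _ (by simp)]
    · simp only [Finset.sum_map, hinv]
      rw [Finsupp.linearCombination_apply, Finsupp.sum_of_support_subset _ hps _ (by simp)]

lemma mem_convexHull_momentEmb (hm : 0 < m) (enc : V ↪ ℕ) (s : Finset V)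
    (z : EuclideanSpace ℝ (Fin m)) :
    z ∈ convexHull ℝ (s.map (momentEmb m hm enc) : Set (EuclideanSpace ℝ (Fin m))) ↔
      ∃ p : V →₀ ℝ, (∀ v, 0 ≤ p v) ∧ mass p = 1 ∧ p.support ⊆ s ∧ momentMap m enc p = z :=
  mem_convexHull_map _ _ _

lemma affineIndependent_momentEmb (hm : 0 < m) (enc : V ↪ ℕ) {s : Finset V}
    (hs : s.card ≤ m + 1) :
    AffineIndependent ℝ ((↑) : s.map (momentEmb m hm enc) → EuclideanSpace ℝ (Fin m)) := by
  classical
  have h : AffineIndependent ℝ fun v : s ↦ momentEmb m hm enc v := by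
    rw [affineIndependent_iff]
    intro t w hw0 hw1 e he
    let p : V →₀ ℝ := ∑ i ∈ t, Finsupp.single i.1 (w i)
    have hp : p = 0 := by
      refine eq_zero_of_momentMap (m := m) enc.injective ?_ ?_
        ((Finset.card_le_card (t := s) ?_).trans hs)
      · simp [p, hw0]
      · rw [← hw1]
        simp [p, momentMap, momentEmb]
      · refine Finsupp.support_finsetSum.trans (Finset.biUnion_subset.2 fun i _ ↦ ?_)
        exact Finsupp.support_single_subset.trans (by simp)
    have := DFunLike.congr_fun hp e.1
    simpa [p, Finsupp.finsetSum_apply, Finsupp.single_apply, he] using this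
  refine h.range.mono ?_
  intro x hx
  simpa [mem_range] using hx

end MomentCurve

/-! ### Relabelling the vertices of a triangulation. -/

section Transfer

variable {X : Type u}

lemma IsUnionOfSimplices.map {V W : Type*} {F : Set (Finset V)} {τ : Finset V → Set X}
    {A : Set X} (h : IsUnionOfSimplices F τ A) (f : V ↪ W) {τ' : Finset W → Set X}
    (hτ : ∀ s ∈ F, τ' (s.map f) = τ s) : IsUnionOfSimplices (Finset.map f '' F) τ' A := by
  ext x
  simp only [mem_iUnion]
  constructor
  · intro hx
    rw [h] at hx
    simp only [mem_iUnion] at hx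
    obtain ⟨s, ⟨hs, hsA⟩, hx⟩ := hx
    rw [← hτ s hs] at hsA hx
    exact ⟨_, ⟨mem_image_of_mem _ hs, hsA⟩, hx⟩
  · rintro ⟨s, ⟨-, hs⟩, hx⟩
    exact hs hx

variable [TopologicalSpace X] {C : Set X} [CWComplex C]

/-- A conical triangulation remains conical when its vertices are relabelled. -/
lemma IsConical.map {V W : Type*} {F : Set (Finset V)} {τ : Finset V → Set X}
    (h : IsConical C F τ) (f : V ↪ W) {τ' : Finset W → Set X}
    (hτ : ∀ s ∈ F, τ' (s.map f) = τ s) : IsConical C (Finset.map f '' F) τ' where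
  closedCell_subcomplex n e := (h.closedCell_subcomplex n e).map f hτ
  cellFrontier_subcomplex n e := (h.cellFrontier_subcomplex n e).map f hτ
  zero_cell e := by
    obtain ⟨s, hs, hs1, hse⟩ := h.zero_cell e
    exact ⟨_, mem_image_of_mem _ hs, by simpa, (hτ s hs).trans hse⟩
  one_cell e := by
    obtain ⟨s, hs, hs1, hse⟩ := h.one_cell e
    exact ⟨_, mem_image_of_mem _ hs, by simpa, (hτ s hs).trans hse⟩
  cone n e hn := by
    obtain ⟨c, hc, hF⟩ := h.cone n e hn
    -- The two families of simplices are compared only on faces, so the apex must be known to be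
    -- one.
    have hcF : {c} ∈ F := (hF.symm.subset (.inl (.inr rfl))).1
    have himage (A : Set X) : {s ∈ Finset.map f '' F | τ' s ⊆ A} =
        Finset.map f '' {s ∈ F | τ s ⊆ A} := by
      ext s
      constructor
      · rintro ⟨⟨s, hs, rfl⟩, hA⟩
        exact ⟨s, ⟨hs, hτ s hs ▸ hA⟩, rfl⟩
      · rintro ⟨s, ⟨hs, hA⟩, rfl⟩
        exact ⟨⟨s, hs, rfl⟩, (hτ s hs).symm ▸ hA⟩
    refine ⟨f c, by rw [← hτ _ hcF, Finset.map_singleton] at hc; exact hc, ?_⟩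
    rw [himage, himage, hF, image_union, image_union, image_singleton, Finset.map_singleton]
    congr 1
    classical
    ext s
    constructor
    · rintro ⟨s, ⟨t, ht, htA, hst⟩, rfl⟩
      refine ⟨_, mem_image_of_mem _ ht, (hτ t ht).symm ▸ htA, ?_⟩
      rw [Finset.coe_map, hst, image_insert_eq, Finset.coe_map]
    · rintro ⟨_, ⟨t, ht, rfl⟩, htA, hst⟩
      refine ⟨insert c t, ⟨t, ht, hτ t ht ▸ htA, by simp⟩, ?_⟩
      rw [← Finset.coe_inj, hst]
      simp

end Transfer

/-! ### The locally finite complex in Euclidean space. -/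

section Euclidean

variable {X : Type u} [TopologicalSpace X] {C : Set X} [CWComplex C]
variable (hC : IsRegular C)
include hC

/-- A face containing `v` is the carrier of a point of a cell whose closure contains the centre of
`v`. There are finitely many such cells, and each closure contains finitely many vertices. -/
lemma finite_faces_of_mem (hlf : IsLocallyFinite C) (v : Vertex C) :
    {s ∈ faces C | v ∈ s}.Finite := by
  have hE : {e : Cell C | v.1.map 0 ∈ e.cls}.Finite := hlf.point_finite _
  have hfin (e : Cell C) : {w : Vertex C | w.1.cls ⊆ e.cls}.Finite :=
    e.finite_subset_cls.preimage Subtype.val_injective.injOn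
  refine (hE.biUnion fun e _ ↦ ((hfin e).toFinset.powerset.finite_toSet)).subset ?_
  rintro _ ⟨⟨x, hx, rfl⟩, hv⟩
  obtain ⟨e, he⟩ := Cell.exists_mem_opn hx
  have hsub (w : Vertex C) (hw : w ∈ (bary C x).support) : w.1.cls ⊆ e.cls :=
    cls_subset_of_bary_ne_zero hC (e.opn_subset_cls he) (Finsupp.mem_support_iff.1 hw)
  refine mem_biUnion (x := e) (hsub v hv (v.1.opn_subset_cls v.1.map_zero_mem_opn)) ?_
  rw [Finset.coe_powerset, mem_preimage, mem_powerset_iff, Finite.coe_toFinset]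
  exact hsub

/-- The geometric simplicial complex with vertices on the moment curve. -/
def euclideanComplex {m : ℕ} (hm : 0 < m) (enc : Vertex C ↪ ℕ)
    (hcard : ∀ s ∈ faces C, 2 * s.card ≤ m + 1) :
    Geometry.SimplicialComplex ℝ (EuclideanSpace ℝ (Fin m)) where
  faces := Finset.map (momentEmb m hm enc) '' faces C
  isRelLowerSet_faces := by
    rintro _ ⟨s, hs, rfl⟩
    refine ⟨by simpa using (isRelLowerSet_faces hC hs).1, fun t hts htn ↦ ?_⟩
    obtain ⟨t, ht, rfl⟩ := Finset.subset_map_iff.1 hts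
    exact mem_image_of_mem _ ((isRelLowerSet_faces hC hs).2 ht (by simpa using htn))
  indep := by
    rintro _ ⟨s, hs, rfl⟩
    exact affineIndependent_momentEmb hm enc (by have := hcard s hs; omega)
  inter_subset_convexHull := by
    classical
    rintro _ _ ⟨s, hs, rfl⟩ ⟨t, ht, rfl⟩ z ⟨hzs, hzt⟩
    obtain ⟨p, hp0, hp1, hps, rfl⟩ := (mem_convexHull_momentEmb hm enc s z).1 hzs
    obtain ⟨q, hq0, hq1, hqt, hpq⟩ := (mem_convexHull_momentEmb hm enc t _).1 hzt
    -- Both weight systems together use at most `m + 1` vertices, so they coincide and are supported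
    -- in `s ∩ t`.
    obtain rfl := eq_of_momentMap_eq enc.injective (hq1.trans hp1.symm) hpq (by
      have := hcard s hs
      have := hcard t ht
      have := Finset.card_le_card hps
      have := Finset.card_le_card hqt
      omega)
    rw [← Finset.coe_inter, ← Finset.map_inter]
    exact (mem_convexHull_momentEmb hm enc _ _).2
      ⟨q, hp0, hp1, Finset.subset_inter hps hqt, rfl⟩

lemma locallyFiniteComplex_euclideanComplex (hlf : IsLocallyFinite C) {m : ℕ} (hm : 0 < m)
    (enc : Vertex C ↪ ℕ) (hcard : ∀ s ∈ faces C, 2 * s.card ≤ m + 1) :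
    LocallyFiniteComplex (euclideanComplex hC hm enc hcard) := by
  intro x hx
  -- The first coordinate of a vertex is its natural number. A simplex meeting this half-space must
  -- have one of the finitely many vertices in it, since otherwise all its convex combinations would
  -- lie outside.
  let U : Set (EuclideanSpace ℝ (Fin m)) := {z | z ⟨0, hm⟩ < x ⟨0, hm⟩ + 1}
  have hU : IsOpen U := isOpen_lt (by fun_prop) continuous_const
  refine ⟨U, hU.mem_nhds (by simp [U]), ?_⟩
  have hV : {v : Vertex C | (enc v : ℝ) < x ⟨0, hm⟩ + 1}.Finite := by
    refine ((finite_Iio ⌈x ⟨0, hm⟩ + 1⌉₊).preimage enc.injective.injOn).subset fun v hv ↦ ?_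
    exact Nat.lt_ceil.2 hv
  refine ((hV.biUnion fun v _ ↦ finite_faces_of_mem hC hlf v).image
    (Finset.map (momentEmb m hm enc))).subset ?_
  rintro _ ⟨⟨s, hs, rfl⟩, z, hz, hzU⟩
  obtain ⟨p, hp0, hp1, hps, rfl⟩ := (mem_convexHull_momentEmb hm enc s z).1 hz
  refine mem_image_of_mem _ ?_
  by_contra hcon
  simp only [mem_iUnion, not_exists] at hcon
  have hlarge (v : Vertex C) (hv : v ∈ p.support) : x ⟨0, hm⟩ + 1 ≤ enc v :=
    not_lt.1 fun h ↦ hcon v h ⟨hs, hps hv⟩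
  have hzU : momentMap m enc p ⟨0, hm⟩ < x ⟨0, hm⟩ + 1 := hzU
  rw [momentMap_coord] at hzU
  refine hzU.not_ge ?_
  calc x ⟨0, hm⟩ + 1 = ∑ v ∈ p.support, p v * (x ⟨0, hm⟩ + 1) := by
        rw [← Finset.sum_mul, show ∑ v ∈ p.support, p v = 1 from (mass_apply p).symm.trans hp1,
          one_mul]
    _ ≤ _ := Finset.sum_le_sum fun v hv ↦ by
      simpa using mul_le_mul_of_nonneg_left (hlarge v hv) (hp0 v)

omit hC in
lemma image_simplex_momentMap (hC : IsRegular C) {m : ℕ} (hm : 0 < m) (enc : Vertex C ↪ ℕ)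
    {s : Finset (Vertex C)} (hs : s ∈ faces C) :
    (fun x ↦ momentMap m enc (bary C x)) '' simplex s =
      convexHull ℝ (s.map (momentEmb m hm enc) : Set (EuclideanSpace ℝ (Fin m))) := by
  ext z
  rw [mem_convexHull_momentEmb]
  constructor
  · rintro ⟨x, ⟨hx, hxs⟩, rfl⟩
    exact ⟨_, bary_nonneg hC hx, mass_bary hC hx, hxs, rfl⟩
  · rintro ⟨p, hp0, hp1, hps, rfl⟩
    obtain ⟨x, hx, rfl⟩ := hs
    obtain ⟨e, he⟩ := Cell.exists_mem_opn hx
    obtain ⟨y, hy, rfl⟩ := exists_bary_eq hC e x (e.opn_subset_cls he) p hp0 hp1 hps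
    exact ⟨y, ⟨e.cls_subset hy, hps⟩, rfl⟩

lemma injOn_momentMap_bary {m : ℕ} (enc : Vertex C ↪ ℕ)
    (hcard : ∀ s ∈ faces C, 2 * s.card ≤ m + 1) :
    InjOn (fun x ↦ momentMap m enc (bary C x)) C := fun x hx y hy h ↦ by
  refine bary_injOn hC hx hy (eq_of_momentMap_eq enc.injective
    ((mass_bary hC hx).trans (mass_bary hC hy).symm) h ?_)
  have := hcard _ (support_mem_faces hx)
  have := hcard _ (support_mem_faces hy)
  omega

lemma image_momentMap_bary {m : ℕ} (hm : 0 < m) (enc : Vertex C ↪ ℕ)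
    (hcard : ∀ s ∈ faces C, 2 * s.card ≤ m + 1) :
    (fun x ↦ momentMap m enc (bary C x)) '' C = (euclideanComplex hC hm enc hcard).space := by
  ext z
  simp only [Geometry.SimplicialComplex.space, mem_iUnion]
  constructor
  · rintro ⟨x, hx, rfl⟩
    refine ⟨_, mem_image_of_mem _ (support_mem_faces hx), ?_⟩
    rw [← image_simplex_momentMap hC hm enc (support_mem_faces hx)]
    exact mem_image_of_mem _ (mem_simplex_support hx)
  · rintro ⟨_, ⟨s, hs, rfl⟩, hz⟩
    rw [← image_simplex_momentMap hC hm enc hs] at hz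
    exact image_mono (fun x hx ↦ hx.1) hz

variable [T2Space X]

lemma continuousOn_momentMap_bary {m : ℕ} (enc : Vertex C → ℕ) {s : Finset (Vertex C)}
    (hs : s ∈ faces C) : ContinuousOn (fun x ↦ momentMap m enc (bary C x)) (simplex s) := by
  have h : ContinuousOn (fun x ↦ ∑ v ∈ s, bary C x v • momentCurve m (enc v)) (simplex s) :=
    continuousOn_finsetSum _ fun v _ ↦ (continuousOn_bary_simplex hC hs v).smul continuousOn_const
  refine h.congr fun x hx ↦ ?_
  rw [momentMap, Finsupp.linearCombination_apply, Finsupp.sum_of_support_subset _ hx.2 _ (by simp)]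

lemma hasEuclideanConicalTriangulation (hfd : RelCWComplex.FiniteDimensional C)
    (hcount : Countable (Σ n, RelCWComplex.cell C n)) (hlf : IsLocallyFinite C) :
    HasEuclideanConicalTriangulation C := by
  obtain ⟨N, hN⟩ := Filter.eventually_atTop.1 hfd.eventually_isEmpty_cell
  obtain ⟨enc₀, henc⟩ := exists_injective_nat (Vertex C)
  let enc : Vertex C ↪ ℕ := ⟨enc₀, henc⟩
  -- All cells have dimension below `N`, so faces have at most `N` vertices and two of them at most
  -- `m + 1`; this choice also keeps `m` positive when `N = 0`.
  let m := 2 * N + 1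
  have hm : 0 < m := Nat.succ_pos _
  have hcard : ∀ s ∈ faces C, 2 * s.card ≤ m + 1 := by
    rintro _ ⟨x, hx, rfl⟩
    obtain ⟨e, he⟩ := Cell.exists_mem_opn hx
    have h1 := card_support_bary_le hC e x (e.opn_subset_cls he)
    have h2 : e.1 < N := not_le.1 fun h ↦ (hN e.1 h).false e.2
    omega
  let S := euclideanComplex hC hm enc hcard
  let f : X → EuclideanSpace ℝ (Fin m) := fun x ↦ momentMap m enc (bary C x)
  have hf : InjOn f C := injOn_momentMap_bary hC enc hcard
  have hfS : f '' C = S.space := image_momentMap_bary hC hm enc hcard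
  let F : C ≃ S.space := (Equiv.Set.imageOfInjOn f C hf).trans (Equiv.setCongr hfS)
  have hF (x : C) : (F x : EuclideanSpace ℝ (Fin m)) = f x := rfl
  have hF' (z) : f (F.symm z) = z := by rw [← hF, F.apply_symm_apply]
  have himage (s) (hs : s ∈ faces C) : f '' simplex s = convexHull ℝ
      (s.map (momentEmb m hm enc) : Set (EuclideanSpace ℝ (Fin m))) :=
    image_simplex_momentMap hC hm enc hs
  have hlfS : LocallyFiniteComplex S :=
    locallyFiniteComplex_euclideanComplex hC hlf hm enc hcard
  have hcont : Continuous F := continuous_induced_rng.2 <|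
    continuous_of_continuousOn_simplex hC fun s hs ↦
      (continuousOn_momentMap_bary hC enc hs).comp (s := Subtype.val ⁻¹' simplex s)
        continuous_subtype_val.continuousOn fun _ h ↦ h
  have hcont' : Continuous F.symm := by
    -- In the subspace topology, continuity of the inverse may be tested on the simplices because
    -- they form a locally finite closed cover.
    have hlf' : LocallyFinite fun s : faces C ↦
        (Subtype.val ⁻¹' (f '' simplex s.1) : Set S.space) := by
      intro z
      obtain ⟨U, hU, hfin⟩ := hlfS z z.2
      refine ⟨Subtype.val ⁻¹' U, continuous_subtype_val.continuousAt.preimage_mem_nhds hU, ?_⟩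
      refine (hfin.preimage (f := fun s : faces C ↦ s.1.map (momentEmb m hm enc))
        fun s _ t _ h ↦ Subtype.ext (Finset.map_injective _ h)).subset ?_
      rintro s ⟨y, hy, hyU⟩
      refine ⟨mem_image_of_mem _ s.2, y, ?_, hyU⟩
      rw [← himage s.1 s.2]
      exact hy
    have himage' (s : faces C) : (Subtype.val ⁻¹' (f '' simplex s.1) : Set S.space) =
        F '' (Subtype.val ⁻¹' simplex s.1) := by
      ext z
      constructor
      · rintro ⟨x, hx, hxz⟩
        exact ⟨⟨x, hx.1⟩, hx, Subtype.ext hxz⟩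
      · rintro ⟨x, hx, rfl⟩
        exact ⟨x, hx, rfl⟩
    have hK (s : faces C) : IsCompact (Subtype.val ⁻¹' simplex s.1 : Set C) :=
      RelCWComplex.isClosed.isClosedEmbedding_subtypeVal.isCompact_preimage
        (isCompact_simplex hC s.2)
    simp only [himage'] at hlf'
    refine hlf'.continuous ?_ (fun s ↦ ((hK s).image hcont).isClosed) fun s ↦
      continuousOn_leftInverse_image (hK s) hcont.continuousOn fun x _ ↦ F.symm_apply_apply x
    exact eq_univ_of_forall fun z ↦ mem_iUnion.2 ⟨⟨_, support_mem_faces (F.symm z).2⟩, F.symm z,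
      mem_simplex_support (F.symm z).2, F.apply_symm_apply z⟩
  refine ⟨m, S, ⟨F.symm, hcont', hcont⟩, hlfS, ?_⟩
  refine (isConical_faces hC).map (momentEmb m hm enc) fun s hs ↦ ?_
  ext x
  constructor
  · rintro ⟨z, hz, rfl⟩
    rw [mem_ofPred_eq, ← himage s hs] at hz
    obtain ⟨y, hy, hyz⟩ := hz
    have : y = F.symm z := hf hy.1 (F.symm z).2 (hyz.trans (hF' z).symm)
    change (F.symm z : X) ∈ _
    rwa [← this]
  · intro hx
    refine ⟨F ⟨x, hx.1⟩, ?_, congrArg Subtype.val (F.symm_apply_apply ⟨x, hx.1⟩)⟩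
    rw [mem_ofPred_eq, ← himage s hs]
    exact mem_image_of_mem f hx

end Euclidean

end RegularCell

end

theorem mainTheorem2 {X : Type*} [TopologicalSpace X] [T2Space X] (C : Set X)
    [Topology.CWComplex C] (hC : RegularCell.IsRegular C) :
    RegularCell.HasConicalTriangulation C ∧
    (Topology.RelCWComplex.FiniteDimensional C →
      Countable (Σ n, Topology.RelCWComplex.cell C n) →
      RegularCell.IsLocallyFinite C →
      RegularCell.HasEuclideanConicalTriangulation C) :=
  ⟨RegularCell.hasConicalTriangulation hC, RegularCell.hasEuclideanConicalTriangulation hC⟩
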